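/- Let $d\ge 1$, let $E$ be a finite set with the discrete $\sigma$-algebra, and let $\Omega=E^{\mathbb Z^d}$ carry the product $\sigma$-algebra $\mathcal F$. For $\Delta\subset\mathbb Z^d$ let $\mathcal F_\Delta$ be the $\sigma$-algebra generated by the spins $\omega_i$, $i\in\Delta$. A specification $\gamma=(\gamma_\Lambda)$ is a family of probability kernels from $(\Omega,\mathcal F)$ to itself, indexed by the finite sets $\Lambda\subset\mathbb Z^d$, such that $\gamma_\Lambda(A|\cdot)$ is $\mathcal F_{\Lambda^c}$-measurable for $A\in\mathcal F$, $\gamma_\Lambda(B|\omega)=\mathbf 1_B(\omega)$ for $B\in\mathcal F_{\Lambda^c}$, and $\gamma_\Lambda\gamma_{\Lambda'}=\gamma_\Lambda$ for $\Lambda'\subset\Lambda$. It is quasilocal if for every finite $\Lambda$ and every local $f$ (i.e. $f:\Omega\to\mathbb R$ is $\mathcal F_\Delta$-measurable for some finite $\Delta$) the function $\gamma_\Lambda f=\int f\,d\gamma_\Lambda(\cdot)$ is a uniform limit of local functions. It is non-null if $\gamma_\Lambda(\{\eta:\eta_\Lambda=\sigma_\Lambda\}\,|\,\omega)>0$ for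 all finite $\Lambda$ and all $\sigma,\omega\in\Omega$. With $(\tau_x\omega)_i=\omega_{i-x}$, it is translation-invariant if $\gamma_{\Lambda+x}(\tau_xA|\tau_x\omega)=\gamma_\Lambda(A|\omega)$ for all finite $\Lambda$, $x\in\mathbb Z^d$, $A\in\mathcal F$ and $\omega\in\Omega$. Let $\mathcal M_{\rm inv}$ be the set of translation-invariant probability measures on $(\Omega,\mathcal F)$ and let $\mathcal G_{\rm inv}(\gamma)$ be the set of $\mu\in\mathcal M_{\rm inv}$ such that $\mu[A|\mathcal F_{\Lambda^c}]=\gamma_\Lambda(A|\cdot)$ $\mu$-a.s. for all finite $\Lambda$ and all $A\in\mathcal F$. With $\Lambda_n=[-n,n]^d\cap\mathbb Z^d$, the relative entropy density is $$h(\mu|\nu)=\lim_{n\to\infty}\frac1{|\Lambda_n|}\sum_{\sigma\in E^{\Lambda_n}}\mu(\sigma)\log\frac{\mu(\sigma)}{\nu(\sigma)},$$ whenever the limit exists, where $\mu(\sigma)=\mu(\{\omega:\omega_{\Lambda_n}=\sigma\})$, $\nu(\sigma)$ is defined likewise, terms with $\mu(\sigma)=0$ are $0$, and the sum is $+\infty$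 if $\nu(\sigma)=0<\mu(\sigma)$ for some $\sigma$. **Theorem.** Let $\gamma$ be a translation-invariant, quasilocal, non-null specification and let $\nu\in\mathcal G_{\rm inv}(\gamma)$. Then for every $\mu\in\mathcal M_{\rm inv}$ the limit $h(\mu|\nu)$ exists and is finite, and $$h(\mu|\nu)=0\iff\mu\in\mathcal G_{\rm inv}(\gamma).$$ -/

import Mathlib

open MeasureTheory ProbabilityTheory Filter Topology
open scoped ENNReal NNReal

namespace LatticeSpin

/-- A specification on the configuration space `S → E` (with its product σ-algebra): a family of
probability kernels indexed by the finite subsets `Λ` of `S`, where `γ_Λ(A | ·)` is measurable with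
respect to the σ-algebra of the spins outside `Λ`, which is proper and consistent. -/
structure Specification (S E : Type*) [MeasurableSpace E] where
  /-- `ker Λ ω A` is `γ_Λ(A | ω)`. -/
  ker : Finset S → Kernel (S → E) (S → E)
  isMarkov : ∀ Λ, IsMarkovKernel (ker Λ)
  measurable_outside : ∀ (Λ : Finset S) (A : Set (S → E)), MeasurableSet A →
    Measurable[cylinderEvents (X := fun _ : S => E) ((Λ : Set S)ᶜ)] (fun ω => ker Λ ω A)
  proper : ∀ (Λ : Finset S) (ω : S → E) (B : Set (S → E)),
    MeasurableSet[cylinderEvents (X := fun _ : S => E) ((Λ : Set S)ᶜ)] B →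
      ker Λ ω B = B.indicator (fun _ => (1 : ℝ≥0∞)) ω
  consistent : ∀ Λ' Λ : Finset S, Λ' ⊆ Λ → ∀ (ω : S → E) (A : Set (S → E)), MeasurableSet A →
    ∫⁻ η, ker Λ' η A ∂(ker Λ ω) = ker Λ ω A

/-- A local function: measurable with respect to the spins in some finite set. -/
def IsLocal {S E : Type*} [MeasurableSpace E] (f : (S → E) → ℝ) : Prop :=
  ∃ Λ : Finset S, Measurable[cylinderEvents (X := fun _ : S => E) (Λ : Set S)] f

/-- A quasilocal function: a uniform limit of local functions. -/
def IsQuasilocalFun {S E : Type*} [MeasurableSpace E] (f : (S → E) → ℝ) : Prop :=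
  ∀ ε : ℝ, 0 < ε → ∃ g : (S → E) → ℝ, IsLocal g ∧ ∀ ω, |f ω - g ω| < ε

namespace Specification

variable {S E : Type*} [MeasurableSpace E]

/-- A quasilocal specification maps local functions to quasilocal functions. -/
def IsQuasilocal (γ : Specification S E) : Prop :=
  ∀ (Λ : Finset S) (f : (S → E) → ℝ), IsLocal f →
    IsQuasilocalFun (fun ω => ∫ σ, f σ ∂(γ.ker Λ ω))

/-- A non-null specification: for each finite `Λ`, every configuration in `Λ` has positive
probability under `γ_Λ`, whatever the boundary condition. -/
def IsNonNull (γ : Specification S E) : Prop :=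
  ∀ (Λ : Finset S) (σ ω : S → E), 0 < γ.ker Λ ω {η | ∀ i ∈ Λ, η i = σ i}

/-- `μ ∈ 𝒢(γ)`: a probability measure whose conditional probabilities given the spins
outside any finite `Λ` are given by `γ_Λ`. -/
def IsDLR (γ : Specification S E) (μ : Measure (S → E)) : Prop :=
  IsProbabilityMeasure μ ∧ ∀ (Λ : Finset S) (A : Set (S → E)), MeasurableSet A →
    μ⟦A | cylinderEvents (X := fun _ : S => E) ((Λ : Set S)ᶜ)⟧
      =ᵐ[μ] fun ω => (γ.ker Λ ω A).toReal

end Specification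

section Lattice

variable {d : ℕ} {E : Type*}

/-- The translation `(τ_x ω)_i = ω_{i - x}` of configurations on `ℤ^d`. -/
def shift (x : Fin d → ℤ) (ω : (Fin d → ℤ) → E) : (Fin d → ℤ) → E :=
  fun i => ω (i - x)

/-- The cube `Λ_n = [-n, n]^d ∩ ℤ^d`. -/
noncomputable def cube (d n : ℕ) : Finset (Fin d → ℤ) :=
  Fintype.piFinset fun _ => Finset.Icc (-(n : ℤ)) (n : ℤ)

variable [MeasurableSpace E]

/-- The set `𝓜_inv` of translation-invariant probability measures. -/
def IsInvariantProb (μ : Measure ((Fin d → ℤ) → E)) : Prop :=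
  IsProbabilityMeasure μ ∧ ∀ x : Fin d → ℤ, μ.map (shift x) = μ

/-- Translation invariance `γ_{Λ + x}(τ_x A | τ_x ω) = γ_Λ(A | ω)` of a specification. -/
def Specification.IsTranslationInvariant (γ : Specification (Fin d → ℤ) E) : Prop :=
  ∀ (x : Fin d → ℤ) (Λ : Finset (Fin d → ℤ)) (ω : (Fin d → ℤ) → E),
    γ.ker (Λ.map (addRightEmbedding x)) (shift x ω) = (γ.ker Λ ω).map (shift x)

/-- `μ ∈ 𝒢_inv(γ)`, the translation-invariant measures consistent with `γ`. -/
def Specification.IsInvariantDLR (γ : Specification (Fin d → ℤ) E)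
    (μ : Measure ((Fin d → ℤ) → E)) : Prop :=
  γ.IsDLR μ ∧ IsInvariantProb μ

/-- The relative entropy `𝓗_Λ(μ | ν)` in a finite volume `Λ`: the Kullback–Leibler divergence of the
marginals on `E^Λ`, which is `∞` when the first is not absolutely continuous with respect to the
second. -/
noncomputable def relEntropy (Λ : Finset (Fin d → ℤ)) (μ ν : Measure ((Fin d → ℤ) → E)) : ℝ≥0∞ :=
  InformationTheory.klDiv (μ.map Λ.restrict) (ν.map Λ.restrict)

/-- The relative entropy density `h(μ | ν) = lim_n 𝓗_{Λ_n}(μ | ν) / |Λ_n|` exists and equals `h`. -/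
def HasRelEntropyDensity (μ ν : Measure ((Fin d → ℤ) → E)) (h : ℝ≥0∞) : Prop :=
  Tendsto (fun n : ℕ => relEntropy (cube d n) μ ν / ((cube d n).card : ℝ≥0∞)) atTop (𝓝 h)

end Lattice

end LatticeSpin

/-! In a cube `Λ` the relative entropy is `∫ log μ(ω_Λ) dμ - ∫ log ν(ω_Λ) dμ`. Per site the first
term converges, to minus the specific entropy of `μ`, because the conditional entropy of a spin
given part of its lexicographic past decreases in that part (`exists_tendsto_integral_logMarginal`).
For the second, change a constant configuration `e` into `ω` one site at a time. Each change
multiplies `ν(·_Λ)` by a ratio of one-site conditional probabilities, which quasilocality and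
non-nullness bring close to a ratio given by `γ` alone, away from the boundary. Hence `∫ log ν(ω_Λ)
dμ - log ν(e_Λ)` grows like `|Λ|` times the `μ`-mean of `siteEnergy γ e`
(`tendsto_integral_logMarginal_sub`).

The unknown `log ν(e_Λ)` is removed by subtracting the same statement with `μ = ν`. The limit is
then `s(μ) - s(ν) - (∫ g dμ - ∫ g dν)`, where `s` is minus the specific entropy and `g = siteEnergy
γ e`. If `μ` is also Gibbs, exchanging `μ` and ν changes the sign of this expression; both relative
entropy densities being nonnegative, they vanish.

Conversely, relative entropy is monotone and translation-invariant in the volume. If its density is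
zero, a tiling argument yields arbitrarily large `D` for which deleting `Λ` from `D` costs almost
nothing (`exists_increment_lt`). A Pinsker-type inequality then says that, under `μ`, the spins of
`D ∩ Λ` given those of `D \ Λ` have nearly the conditional law they have under `ν`, which
quasilocality compares with `γ_Λ`. So `μ γ_Λ = μ`, and properness of `γ` turns this into the DLR
equations. -/

namespace LatticeSpin

/-! ### Pinsker-type inequalities on finite sets -/

section FiniteEntropy

/-- The bound `log x ≤ x - 1` at `x = √(m/p)` bounds the squared Hellinger distance by the relative
entropy; Cauchy–Schwarz passes to the `ℓ¹` distance. The constant 4 is not optimal, but any constant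
would do. -/
theorem sq_sum_abs_sub_le_relEntropy {A : Type*} [Fintype A] (p m : A → ℝ)
    (hp : ∀ a, 0 ≤ p a) (hm : ∀ a, 0 ≤ m a) (hp1 : ∑ a, p a = 1) (hm1 : ∑ a, m a ≤ 1)
    (hac : ∀ a, m a = 0 → p a = 0) :
    (∑ a, |p a - m a|) ^ 2 ≤ 4 * ∑ a, p a * (Real.log (p a) - Real.log (m a)) := by
  have hellinger : ∑ a, (√(p a) - √(m a)) ^ 2 ≤
      ∑ a, p a * (Real.log (p a) - Real.log (m a)) := by
    have h1 : ∀ a, 2 * p a - 2 * (√(p a) * √(m a)) ≤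
        p a * (Real.log (p a) - Real.log (m a)) := by
      intro a
      rcases (hp a).eq_or_lt with h | h
      · simp [← h]
      · have hma : 0 < m a := (hm a).lt_of_ne fun h0 => h.ne' (hac a h0.symm)
        have hl := Real.log_le_sub_one_of_pos (div_pos (Real.sqrt_pos.2 hma) (Real.sqrt_pos.2 h))
        rw [Real.log_div (Real.sqrt_pos.2 hma).ne' (Real.sqrt_pos.2 h).ne',
          Real.log_sqrt hma.le, Real.log_sqrt h.le] at hl
        have h2 := mul_le_mul_of_nonneg_left hl h.le
        have h3 : p a * (√(m a) / √(p a)) = √(p a) * √(m a) := by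
          have h4 := (Real.sqrt_pos.2 h).ne'
          field_simp
          rw [Real.sq_sqrt h.le]
        nlinarith
    calc ∑ a, (√(p a) - √(m a)) ^ 2
        = ∑ a, p a + ∑ a, m a - 2 * ∑ a, √(p a) * √(m a) := by
          rw [Finset.mul_sum, ← Finset.sum_add_distrib, ← Finset.sum_sub_distrib]
          refine Finset.sum_congr rfl fun a _ => ?_
          rw [sub_sq, Real.sq_sqrt (hp a), Real.sq_sqrt (hm a)]
          ring
      _ ≤ ∑ a, (2 * p a - 2 * (√(p a) * √(m a))) := by
          rw [Finset.sum_sub_distrib, ← Finset.mul_sum, ← Finset.mul_sum]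
          linarith
      _ ≤ _ := Finset.sum_le_sum fun a _ => h1 a
  have hplus : ∑ a, (√(p a) + √(m a)) ^ 2 ≤ 4 := by
    calc ∑ a, (√(p a) + √(m a)) ^ 2 ≤ ∑ a, (2 * p a + 2 * m a) := by
          refine Finset.sum_le_sum fun a _ => ?_
          nlinarith [sq_nonneg (√(p a) - √(m a)), Real.sq_sqrt (hp a), Real.sq_sqrt (hm a)]
      _ ≤ 4 := by
          rw [Finset.sum_add_distrib, ← Finset.mul_sum, ← Finset.mul_sum]
          linarith
  calc (∑ a, |p a - m a|) ^ 2
      = (∑ a, |√(p a) - √(m a)| * (√(p a) + √(m a))) ^ 2 := by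
        congr 1
        refine Finset.sum_congr rfl fun a _ => ?_
        conv_rhs => rw [← abs_of_nonneg (add_nonneg (Real.sqrt_nonneg (p a))
          (Real.sqrt_nonneg (m a))), ← abs_mul]
        congr 1
        linear_combination (-1) * Real.sq_sqrt (hp a) + Real.sq_sqrt (hm a)
    _ ≤ (∑ a, |√(p a) - √(m a)| ^ 2) * ∑ a, (√(p a) + √(m a)) ^ 2 :=
        Finset.sum_mul_sq_le_sq_mul_sq _ _ _
    _ ≤ (∑ a, p a * (Real.log (p a) - Real.log (m a))) * 4 := by
        simp only [sq_abs]
        exact mul_le_mul hellinger hplus (Finset.sum_nonneg fun _ _ => sq_nonneg _)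
          ((Finset.sum_nonneg fun _ _ => sq_nonneg _).trans hellinger)
    _ = _ := mul_comm _ _

/-- The previous bound with `m` built from the image `p'` and the conditional law of `q` on the
fibres of `π`; by the chain rule the right side is a difference of two relative entropies. Its
nonnegativity alone gives the monotonicity of conditional entropy and of relative entropy. The total
mass of `q` is left free. -/
theorem sq_sum_abs_sub_le_condRelEntropy {A B : Type*} [Fintype A] [Fintype B] [DecidableEq B]
    (π : A → B) (p q : A → ℝ) (p' q' : B → ℝ)
    (hp' : ∀ b, p' b = ∑ a with π a = b, p a) (hq' : ∀ b, q' b = ∑ a with π a = b, q a)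
    (hp : ∀ a, 0 ≤ p a) (hq : ∀ a, 0 ≤ q a) (hp1 : ∑ a, p a = 1)
    (hac : ∀ a, q a = 0 → p a = 0) :
    (∑ a, |p a - p' (π a) * q a / q' (π a)|) ^ 2 ≤
      4 * ∑ a, p a * (Real.log (p a) - Real.log (q a) -
        (Real.log (p' (π a)) - Real.log (q' (π a)))) := by
  have hp'0 : ∀ b, 0 ≤ p' b := fun b => by
    rw [hp']; exact Finset.sum_nonneg fun a _ => hp a
  have hq'0 : ∀ b, 0 ≤ q' b := fun b => by
    rw [hq']; exact Finset.sum_nonneg fun a _ => hq a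
  have hpp' : ∀ a, p a ≤ p' (π a) := fun a => by
    rw [hp']; exact Finset.single_le_sum (f := p) (fun i _ => hp i) (by simp)
  have hqq' : ∀ a, q a ≤ q' (π a) := fun a => by
    rw [hq']; exact Finset.single_le_sum (f := q) (fun i _ => hq i) (by simp)
  have hpos : ∀ a, p a ≠ 0 → 0 < p a ∧ 0 < q a ∧ 0 < p' (π a) ∧ 0 < q' (π a) := by
    intro a ha
    have h1 : 0 < p a := (hp a).lt_of_ne' ha
    have h2 : 0 < q a := (hq a).lt_of_ne' fun h => ha (hac a h)
    exact ⟨h1, h2, h1.trans_le (hpp' a), h2.trans_le (hqq' a)⟩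
  have key := sq_sum_abs_sub_le_relEntropy p (fun a => p' (π a) * q a / q' (π a)) hp
    (fun a => div_nonneg (mul_nonneg (hp'0 _) (hq a)) (hq'0 _)) hp1 ?_ ?_
  · refine key.trans_eq ?_
    congr 1
    refine Finset.sum_congr rfl fun a _ => ?_
    by_cases ha : p a = 0
    · simp [ha]
    · obtain ⟨_, h2, h3, h4⟩ := hpos a ha
      rw [Real.log_div (mul_pos h3 h2).ne' h4.ne', Real.log_mul h3.ne' h2.ne']
      ring
  · calc ∑ a, p' (π a) * q a / q' (π a)
        = ∑ b, ∑ a with π a = b, p' (π a) * q a / q' (π a) :=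
          (Finset.sum_fiberwise _ _ _).symm
      _ ≤ ∑ b, p' b := by
          refine Finset.sum_le_sum fun b _ => ?_
          have : ∑ a with π a = b, p' (π a) * q a / q' (π a) = p' b * q' b / q' b := by
            rw [hq' b, Finset.mul_sum, Finset.sum_div, ← hq' b]
            refine Finset.sum_congr rfl fun a ha => ?_
            rw [(Finset.mem_filter.1 ha).2]
          rw [this]
          rcases (hq'0 b).eq_or_lt with h | h
          · simp [← h, hp'0 b]
          · rw [mul_div_cancel_right₀ _ h.ne']
      _ = 1 := by
          simp only [hp']
          rw [Finset.sum_fiberwise, hp1]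
  · intro a ha
    by_contra h
    obtain ⟨_, h2, h3, h4⟩ := hpos a h
    exact (div_pos (mul_pos h3 h2) h4).ne' ha

end FiniteEntropy

/-! ### Random variables with finitely many values -/

section FiniteValued

theorem ae_measureReal_fiber_pos {Ω A : Type*} [MeasurableSpace Ω] [Finite A] {μ : Measure Ω}
    [IsFiniteMeasure μ] {X : Ω → A} : ∀ᵐ ω ∂μ, 0 < μ.real (X ⁻¹' {X ω}) := by
  have h : ∀ a : A, ∀ᵐ ω ∂μ, X ω = a → 0 < μ.real (X ⁻¹' {a}) := by
    intro a
    rcases (measureReal_nonneg (μ := μ) (s := X ⁻¹' {a})).eq_or_lt with h0 | h0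
    · have : μ (X ⁻¹' {a}) = 0 := by
        simpa [measureReal_def, ENNReal.toReal_eq_zero_iff] using h0.symm
      filter_upwards [measure_eq_zero_iff_ae_notMem.1 this] with ω hω h
      exact absurd h hω
    · exact Eventually.of_forall fun _ _ => h0
  filter_upwards [ae_all_iff.2 h] with ω hω
  exact hω _ rfl

variable {Ω A B : Type*} [MeasurableSpace Ω] [Finite A] [MeasurableSpace A]
  [MeasurableSingletonClass A] {μ : Measure Ω} [IsProbabilityMeasure μ] {X : Ω → A}

theorem integrable_comp_finite (hX : Measurable X) (F : A → ℝ) :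
    Integrable (fun ω => F (X ω)) μ := by
  have : IsProbabilityMeasure (μ.map X) := Measure.isProbabilityMeasure_map hX.aemeasurable
  exact (Integrable.of_finite (μ := μ.map X) (f := F)).comp_measurable hX

theorem integral_comp_finite {A : Type*} [Fintype A] [MeasurableSpace A]
    [MeasurableSingletonClass A] {X : Ω → A} (hX : Measurable X) (F : A → ℝ) :
    ∫ ω, F (X ω) ∂μ = ∑ a, μ.real (X ⁻¹' {a}) * F a := by
  have : IsProbabilityMeasure (μ.map X) := Measure.isProbabilityMeasure_map hX.aemeasurable
  rw [← integral_map hX.aemeasurable (Integrable.of_finite (f := F)).aestronglyMeasurable,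
    integral_fintype (Integrable.of_finite (f := F))]
  simp [map_measureReal_apply hX (measurableSet_singleton _)]

theorem measureReal_preimage_eq_sum {A : Type*} [Fintype A] [MeasurableSpace A]
    [MeasurableSingletonClass A] {X : Ω → A} (hX : Measurable X) (s : A → Prop)
    [DecidablePred s] :
    μ.real (X ⁻¹' {a | s a}) = ∑ a with s a, μ.real (X ⁻¹' {a}) := by
  have h : X ⁻¹' {a | s a} = ⋃ a ∈ Finset.univ.filter s, X ⁻¹' {a} := by
    ext ω; simp
  rw [h, measureReal_biUnion_finset]
  · exact fun a _ b _ hab => Set.disjoint_left.2 fun ω ha hb => hab (ha.symm.trans hb)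
  · exact fun a _ => hX (measurableSet_singleton a)

theorem klDiv_eq_ofReal_integral {P Q : Measure A} [IsProbabilityMeasure P]
    [IsProbabilityMeasure Q] (hQ : ∀ a, 0 < Q.real {a}) :
    InformationTheory.klDiv P Q =
      ENNReal.ofReal (∫ a, (Real.log (P.real {a}) - Real.log (Q.real {a})) ∂P) := by
  have hac : P ≪ Q := by
    intro s hs
    have : s = ∅ := by
      by_contra hne
      obtain ⟨a, ha⟩ := Set.nonempty_iff_ne_empty.2 hne
      have h1 := measure_mono_null (Set.singleton_subset_iff.2 ha) hs
      exact (hQ a).ne' (by simp [measureReal_def, h1])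
    simp [this]
  have hint : Integrable (llr P Q) P := Integrable.of_finite
  rw [← ENNReal.ofReal_toReal (InformationTheory.klDiv_ne_top hac hint),
    InformationTheory.toReal_klDiv_of_measure_eq hac (by simp)]
  congr 1
  refine integral_congr_ae ?_
  have hrn : ∀ a, P {a} = P.rnDeriv Q a * Q {a} := by
    intro a
    conv_lhs => rw [← Measure.withDensity_rnDeriv_eq P Q hac]
    rw [withDensity_apply _ (measurableSet_singleton a)]
    simp [mul_comm]
  have hpos : ∀ᵐ a ∂P, 0 < P.real {a} := by
    simpa using ae_measureReal_fiber_pos (μ := P) (X := id)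
  filter_upwards [hpos] with a ha
  have h0 := hrn a
  have hr : P.real {a} = (P.rnDeriv Q a).toReal * Q.real {a} := by
    simp [measureReal_def, h0]
  have hr0 : (P.rnDeriv Q a).toReal ≠ 0 := fun h => ha.ne' (by simp [hr, h])
  rw [llr, hr, Real.log_mul hr0 (hQ a).ne']
  ring

end FiniteValued

/-! ### Marginals and cylinder events -/

section Marginal

variable {S E : Type*} [MeasurableSpace E]

/-- The probability that the spins in `Λ` are given by `σ`. -/
noncomputable def marginal (μ : Measure (S → E)) (Λ : Finset S) (σ : Λ → E) : ℝ :=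
  μ.real (Λ.restrict ⁻¹' {σ})

theorem restrict_preimage_singleton {S E : Type*} (Λ : Finset S) (ω : S → E) :
    (Λ.restrict (π := fun _ => E)) ⁻¹' {Λ.restrict ω} = {η | ∀ i ∈ Λ, η i = ω i} := by
  ext η
  simp [funext_iff]

theorem measurable_restrict_cylinderEvents_coe (Λ : Finset S) :
    Measurable[cylinderEvents (X := fun _ : S => E) (Λ : Set S)] (Λ.restrict (π := fun _ => E)) :=
  (@measurable_pi_iff _ _ _ (cylinderEvents (X := fun _ : S => E) (Λ : Set S)) _ _).2
    fun i => measurable_cylinderEvent_apply (X := fun _ : S => E) i.2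

theorem eq_of_measurable_cylinderEvents {β : Type*} [MeasurableSpace β]
    [MeasurableSingletonClass β] {Δ : Set S} {f : (S → E) → β}
    (hf : Measurable[cylinderEvents (X := fun _ : S => E) Δ] f) {ω ω' : S → E}
    (h : ∀ i ∈ Δ, ω i = ω' i) : f ω = f ω' := by
  -- Only dependence on the coordinates in `Δ` matters, so the restrictions may carry the σ-algebra
  -- `⊤`.
  have hle : cylinderEvents (X := fun _ : S => E) Δ ≤
      MeasurableSpace.comap (Set.domRestrict Δ) ⊤ := by
    refine iSup₂_le fun i hi => ?_
    rintro _ ⟨t, _, rfl⟩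
    exact ⟨{σ | σ ⟨i, hi⟩ ∈ t}, trivial, rfl⟩
  obtain ⟨t, _, ht⟩ := hle _ (hf (measurableSet_singleton (f ω')))
  have hr : Set.domRestrict Δ ω = Set.domRestrict Δ ω' := funext fun i => h i i.2
  have h1 : ω' ∈ f ⁻¹' {f ω'} := rfl
  have h2 : ω ∈ f ⁻¹' {f ω'} := by
    rw [← ht] at h1 ⊢
    simpa [Set.mem_preimage, hr] using h1
  exact h2

end Marginal

/-! ### Gibbs measures, quasilocality and non-nullness -/

namespace Specification

variable {S E : Type*} [MeasurableSpace E] {γ : Specification S E}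

theorem measurable_measureReal (γ : Specification S E) (Λ : Finset S) {A : Set (S → E)}
    (hA : MeasurableSet A) : Measurable fun ω => (γ.ker Λ ω).real A :=
  ((γ.ker Λ).measurable_coe hA).ennreal_toReal

theorem measureReal_le_one (γ : Specification S E) (Λ : Finset S) (A : Set (S → E)) (ω : S → E) :
    (γ.ker Λ ω).real A ≤ 1 := by
  have := γ.isMarkov Λ
  exact _root_.MeasureTheory.measureReal_le_one

theorem integrable_measureReal (γ : Specification S E) (μ : Measure (S → E)) [IsFiniteMeasure μ]
    (Λ : Finset S) {A : Set (S → E)} (hA : MeasurableSet A) :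
    Integrable (fun ω => (γ.ker Λ ω).real A) μ := by
  refine Integrable.of_bound (γ.measurable_measureReal Λ hA).aestronglyMeasurable 1
    (Eventually.of_forall fun ω => ?_)
  rw [Real.norm_of_nonneg measureReal_nonneg]
  exact γ.measureReal_le_one Λ A ω

theorem IsDLR.measureReal_inter {ν : Measure (S → E)} (hν : γ.IsDLR ν) (Λ : Finset S)
    {A B : Set (S → E)} (hA : MeasurableSet A)
    (hB : MeasurableSet[cylinderEvents (X := fun _ : S => E) ((Λ : Set S)ᶜ)] B) :
    ν.real (A ∩ B) = ∫ ω in B, (γ.ker Λ ω).real A ∂ν := by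
  have := hν.1
  have h := setIntegral_condExp (μ := ν) (f := A.indicator fun _ => (1 : ℝ))
    (cylinderEvents_le_pi (X := fun _ : S => E) (Δ := (Λ : Set S)ᶜ))
    ((integrable_const (1 : ℝ)).indicator hA) hB
  rw [setIntegral_congr_ae (cylinderEvents_le_pi _ hB)
    ((hν.2 Λ A hA).mono fun ω hω _ => hω)] at h
  simp only [measureReal_def] at h ⊢
  rw [h, integral_indicator hA, Measure.restrict_restrict hA]
  simp [measureReal_def]

variable [Finite E] [DiscreteMeasurableSpace E]

/-- The probability of a local event under a quasilocal specification is nearly determined by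
finitely many spins outside the volume. -/
theorem IsQuasilocal.exists_finset (hγ : γ.IsQuasilocal) (Λ Δ : Finset S) (T : Set (Δ → E))
    {ε : ℝ} (hε : 0 < ε) :
    ∃ W : Finset S, ∀ ω ω' : S → E, (∀ i ∈ W, i ∉ Λ → ω i = ω' i) →
      |(γ.ker Λ ω).real (Δ.restrict ⁻¹' T) - (γ.ker Λ ω').real (Δ.restrict ⁻¹' T)| ≤ ε := by
  classical
  have hT : MeasurableSet[cylinderEvents (X := fun _ : S => E) (Δ : Set S)]
      (Δ.restrict (π := fun _ => E) ⁻¹' T) :=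
    measurable_restrict_cylinderEvents_coe Δ (MeasurableSet.of_discrete)
  have hloc : IsLocal ((Δ.restrict (π := fun _ => E) ⁻¹' T).indicator (1 : (S → E) → ℝ)) :=
    ⟨Δ, (@measurable_const ℝ (S → E) _
      (cylinderEvents (X := fun _ : S => E) (Δ : Set S)) 1).indicator hT⟩
  obtain ⟨g, ⟨W, hW⟩, hg⟩ := hγ Λ _ hloc (ε / 2) (half_pos hε)
  simp only [integral_indicator_one (cylinderEvents_le_pi _ hT)] at hg
  refine ⟨W, fun ω ω' h => ?_⟩
  -- The hybrid equal to `ω` in `Λ` and to `ω'` outside: the kernel cannot tell it from `ω'`, nor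
  -- `g` from `ω`.
  have h1 : (γ.ker Λ ω').real (Δ.restrict ⁻¹' T) =
      (γ.ker Λ (Λ.piecewise ω ω')).real (Δ.restrict ⁻¹' T) := by
    rw [measureReal_def, measureReal_def, eq_of_measurable_cylinderEvents
      (γ.measurable_outside Λ _ (cylinderEvents_le_pi _ hT))]
    intro i hi
    simp [Finset.piecewise_eq_of_notMem _ _ _ (show i ∉ Λ from hi)]
  have h2 : g ω = g (Λ.piecewise ω ω') := by
    refine eq_of_measurable_cylinderEvents hW fun i hi => ?_
    by_cases hΛ : i ∈ Λ
    · simp [hΛ]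
    · simp [hΛ, h i hi hΛ]
  have h3 := abs_lt.1 (hg ω)
  have h4 := abs_lt.1 (hg (Λ.piecewise ω ω'))
  rw [h1, abs_le]
  constructor <;> linarith

theorem IsDLR.marginal_pos {ν : Measure (S → E)} (hν : γ.IsDLR ν) (hγ : γ.IsNonNull)
    (Λ : Finset S) (σ : Λ → E) : 0 < marginal ν Λ σ := by
  classical
  have := hν.1
  have hS : Nonempty (S → E) := (nonempty_of_isProbabilityMeasure ν)
  obtain ⟨ω₀⟩ := hS
  obtain ⟨ω, rfl⟩ : ∃ ω : S → E, Λ.restrict ω = σ :=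
    ⟨fun i => if h : i ∈ Λ then σ ⟨i, h⟩ else ω₀ i, by ext i; simp⟩
  have hA : MeasurableSet (Λ.restrict (π := fun _ => E) ⁻¹' {Λ.restrict ω}) :=
    Finset.measurable_restrict Λ (measurableSet_singleton _)
  have h := hν.measureReal_inter Λ hA MeasurableSet.univ
  rw [Set.inter_univ, setIntegral_univ] at h
  rw [marginal, h, integral_pos_iff_support_of_nonneg (fun _ => measureReal_nonneg)
    (γ.integrable_measureReal ν Λ hA)]
  have : Function.support (fun ω' => (γ.ker Λ ω').real
      (Λ.restrict (π := fun _ => E) ⁻¹' {Λ.restrict ω})) = Set.univ := by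
    refine Set.eq_univ_of_forall fun ω' => ?_
    have := γ.isMarkov Λ
    rw [Function.mem_support, restrict_preimage_singleton, measureReal_def]
    exact (ENNReal.toReal_pos (hγ Λ ω ω').ne' (measure_ne_top _ _)).ne'
  simp [this]

/-- The measures that give the right probability to local events after resampling in any
finite volume are the measures consistent with the specification. -/
theorem isDLR_of_integral_eq {μ : Measure (S → E)} [IsProbabilityMeasure μ]
    (h : ∀ (Λ Δ : Finset S) (T : Set (Δ → E)),
      ∫ ω, (γ.ker Λ ω).real (Δ.restrict ⁻¹' T) ∂μ = μ.real (Δ.restrict ⁻¹' T)) :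
    γ.IsDLR μ := by
  refine ⟨inferInstance, fun Λ A hA => ?_⟩
  have := γ.isMarkov Λ
  have hof : ∀ ω (B : Set (S → E)), ENNReal.ofReal ((γ.ker Λ ω).real B) = γ.ker Λ ω B :=
    fun _ _ => ofReal_measureReal
  -- Invariance under `γ_Λ` extends from cylinders, which form a generating π-system, to all events.
  have hbind : μ.bind (γ.ker Λ) = μ := by
    have : IsProbabilityMeasure (μ.bind (γ.ker Λ)) := inferInstance
    refine ext_of_generate_finite _ generateFrom_measurableCylinders.symm
      isPiSystem_measurableCylinders (fun s hs => ?_) (by simp)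
    obtain ⟨Δ, T, _, rfl⟩ := (mem_measurableCylinders s).1 hs
    have hm : MeasurableSet (Δ.restrict (π := fun _ => E) ⁻¹' T) :=
      Finset.measurable_restrict Δ MeasurableSet.of_discrete
    change (μ.bind (γ.ker Λ)) (Δ.restrict ⁻¹' T) = _
    have h1 := h Λ Δ T
    rw [Measure.bind_apply hm (γ.ker Λ).measurable.aemeasurable]
    have h2 := ofReal_integral_eq_lintegral_ofReal (γ.integrable_measureReal μ Λ hm)
      (Eventually.of_forall fun _ => measureReal_nonneg)
    simp only [hof] at h2
    rw [← h2]
    rw [h1, ofReal_measureReal]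
    rfl
  symm
  refine ae_eq_condExp_of_forall_setIntegral_eq cylinderEvents_le_pi
    ((integrable_const (1 : ℝ)).indicator hA) (fun s _ _ =>
      (γ.integrable_measureReal μ Λ hA).integrableOn) (fun B hB _ => ?_)
    (Measurable.stronglyMeasurable
      ((γ.measurable_outside Λ A hA).ennreal_toReal)).aestronglyMeasurable
  have hB' := cylinderEvents_le_pi _ hB
  rw [integral_indicator hA, Measure.restrict_restrict hA]
  simp only [integral_const, MeasurableSet.univ, measureReal_restrict_apply, Set.univ_inter,
    smul_eq_mul, mul_one]
  -- Properness: `γ_Λ(·|ω)` is carried by `B` or by its complement according to whether `ω ∈ B`.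
  have h3 : ∀ ω, B.indicator (fun ω => γ.ker Λ ω A) ω = γ.ker Λ ω (A ∩ B) := by
    intro ω
    have hp := γ.proper Λ ω B hB
    by_cases hω : ω ∈ B
    · simp only [hω, Set.indicator_of_mem] at hp ⊢
      rw [← prob_compl_eq_zero_iff hB'] at hp
      exact (measure_inter_conull hp).symm
    · simp only [hω, not_false_eq_true, Set.indicator_of_notMem] at hp ⊢
      exact (measure_mono_null Set.inter_subset_right hp).symm
  have h4 : ∫⁻ ω in B, γ.ker Λ ω A ∂μ = μ (A ∩ B) := by
    rw [← lintegral_indicator hB', lintegral_congr h3,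
      ← Measure.bind_apply (hA.inter hB') (γ.ker Λ).measurable.aemeasurable, hbind]
  have h5 := ofReal_integral_eq_lintegral_ofReal
    (μ := μ.restrict B) (γ.integrable_measureReal μ Λ hA).integrableOn
      (Eventually.of_forall fun _ => measureReal_nonneg)
  simp only [hof] at h5
  rw [h4] at h5
  rw [measureReal_def, ← h5, ENNReal.toReal_ofReal]
  · rfl
  · exact integral_nonneg fun _ => measureReal_nonneg

/-- With `E` discrete, the configuration space is compact and quasilocality makes the probability
continuous in the boundary condition, so it attains a positive minimum. -/
theorem IsQuasilocal.exists_pos_le (hγ : γ.IsQuasilocal) (Λ Δ : Finset S) (T : Set (Δ → E))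
    (hpos : ∀ ω, 0 < (γ.ker Λ ω).real (Δ.restrict ⁻¹' T)) :
    ∃ δ : ℝ, 0 < δ ∧ ∀ ω, δ ≤ (γ.ker Λ ω).real (Δ.restrict ⁻¹' T) := by
  let _ : TopologicalSpace E := ⊥
  have _ : DiscreteTopology E := ⟨rfl⟩
  rcases isEmpty_or_nonempty (S → E) with hS | hS
  · exact ⟨1, one_pos, fun ω => isEmptyElim ω⟩
  have hc : Continuous fun ω => (γ.ker Λ ω).real (Δ.restrict ⁻¹' T) := by
    rw [continuous_iff_continuousAt]
    intro ω
    rw [ContinuousAt, Metric.tendsto_nhds]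
    intro ε hε
    obtain ⟨W, hW⟩ := hγ.exists_finset Λ Δ T (half_pos hε)
    have : ∀ᶠ η in 𝓝 ω, ∀ i ∈ W, η i = ω i := by
      rw [Filter.eventually_all_finset]
      intro i _
      exact (continuous_apply i).continuousAt.eventually
        (f := fun η : S → E => η i) (p := fun e => e = ω i) (by simp [nhds_discrete])
    filter_upwards [this] with η hη
    rw [Real.dist_eq]
    exact (hW η ω fun i hi _ => hη i hi).trans_lt (half_lt_self hε)
  obtain ⟨ω, -, hω⟩ := isCompact_univ.exists_isMinOn Set.univ_nonempty hc.continuousOn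
  exact ⟨_, hpos ω, fun η => hω (Set.mem_univ η)⟩

end Specification

/-! ### Telescoping along a linear order -/

section Chain

theorem sum_increment_eq_sub {S α : Type*} [DecidableEq S] [LinearOrder α] (key : S → α)
    (hkey : Function.Injective key) (r : S → S → Prop) [∀ k, DecidablePred fun i => r i k]
    (hr : ∀ i k, r i k ↔ key i < key k) (F : Finset S → ℝ) (Λ : Finset S) :
    ∑ k ∈ Λ, (F (insert k {i ∈ Λ | r i k}) - F {i ∈ Λ | r i k}) = F Λ - F ∅ := by
  induction Λ using Finset.induction_on_max_value key with
  | empty => simp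
  | insert a s ha hmax ih =>
    have hlt : ∀ x ∈ s, r x a := fun x hx =>
      (hr x a).2 ((hmax x hx).lt_of_ne fun h => ha (hkey h ▸ hx))
    have hirr : ∀ x y, r x y → ¬ r y x := fun x y h h' =>
      lt_asymm ((hr x y).1 h) ((hr y x).1 h')
    have h1 : {i ∈ insert a s | r i a} = s := by
      ext i
      simp only [Finset.mem_filter, Finset.mem_insert]
      constructor
      · rintro ⟨rfl | h, h'⟩
        · exact absurd h' (hirr _ _ h')
        · exact h
      · exact fun h => ⟨Or.inr h, hlt i h⟩
    have h2 : ∀ k ∈ s, {i ∈ insert a s | r i k} = {i ∈ s | r i k} := by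
      intro k hk
      rw [Finset.filter_insert, if_neg (hirr _ _ (hlt k hk))]
    rw [Finset.sum_insert ha, h1, Finset.sum_congr rfl fun k hk => by rw [h2 k hk], ih]
    ring

end Chain

/-! ### Cubes and spatial averages -/

section Cube

variable {d : ℕ}

theorem mem_cube {n : ℕ} {x : Fin d → ℤ} : x ∈ cube d n ↔ ∀ j, -(n : ℤ) ≤ x j ∧ x j ≤ n := by
  simp [cube]

theorem card_cube (n : ℕ) : (cube d n).card = (2 * n + 1) ^ d := by
  rw [cube, Fintype.card_piFinset_const, Int.card_Icc]
  congr 1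
  omega

theorem cube_mono : Monotone (cube d) := by
  intro m n h x hx
  rw [mem_cube] at hx ⊢
  intro j
  have := hx j
  omega

theorem exists_subset_cube (W : Finset (Fin d → ℤ)) : ∃ m, W ⊆ cube d m := by
  refine ⟨∑ x ∈ W, ∑ j, (x j).natAbs, fun x hx => mem_cube.2 fun j => ?_⟩
  have h1 : (x j).natAbs ≤ ∑ j, (x j).natAbs :=
    Finset.single_le_sum (f := fun j => (x j).natAbs) (fun _ _ => zero_le) (Finset.mem_univ j)
  have h2 : ∑ j, (x j).natAbs ≤ ∑ x ∈ W, ∑ j, (x j).natAbs :=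
    Finset.single_le_sum (f := fun x => ∑ j, (x j).natAbs) (fun _ _ => zero_le) hx
  omega

theorem tendsto_card_cube_div (d m : ℕ) :
    Tendsto (fun n => ((cube d (n - m)).card : ℝ) / (cube d n).card) atTop (𝓝 1) := by
  have h1 : Tendsto (fun n : ℕ => 1 - 2 * (m : ℝ) / (2 * n + 1)) atTop (𝓝 (1 - 0)) := by
    refine tendsto_const_nhds.sub (tendsto_const_nhds.div_atTop ?_)
    exact tendsto_atTop_add_const_right _ _
      (tendsto_natCast_atTop_atTop.const_mul_atTop two_pos)
  have h2 := h1.pow d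
  simp only [sub_zero, one_pow] at h2
  refine h2.congr' ?_
  filter_upwards [eventually_ge_atTop m] with n hn
  rw [card_cube, card_cube]
  push_cast [Nat.cast_sub hn]
  rw [← div_pow]
  congr 1
  have : (2 * (n : ℝ) + 1) ≠ 0 := by positivity
  field_simp
  ring

/-- Averages over cubes of bounded quantities that are nearly constant away from the boundary. -/
theorem tendsto_cube_average {t : ℕ → (Fin d → ℤ) → ℝ} {K L : ℝ}
    (hK : ∀ n, ∀ k ∈ cube d n, |t n k| ≤ K)
    (hL : ∀ ε > 0, ∃ m : ℕ, ∀ n k, (∀ i ∈ cube d m, i + k ∈ cube d n) → |t n k - L| ≤ ε) :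
    Tendsto (fun n => (∑ k ∈ cube d n, t n k) / (cube d n).card) atTop (𝓝 L) := by
  rw [Metric.tendsto_nhds]
  intro ε hε
  obtain ⟨m, hm⟩ := hL (ε / 2) (half_pos hε)
  have h0 : Tendsto (fun n => (K + |L|) * (1 - ((cube d (n - m)).card : ℝ) / (cube d n).card))
      atTop (𝓝 ((K + |L|) * (1 - 1))) :=
    tendsto_const_nhds.mul (tendsto_const_nhds.sub (tendsto_card_cube_div d m))
  rw [sub_self, mul_zero] at h0
  filter_upwards [h0.eventually (gt_mem_nhds (half_pos hε)), eventually_ge_atTop m] with n hn hmn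
  have hc : 0 < ((cube d n).card : ℝ) := by
    rw [card_cube]; positivity
  have hsub : cube d (n - m) ⊆ cube d n := cube_mono (Nat.sub_le n m)
  rw [Real.dist_eq]
  have h1 : (∑ k ∈ cube d n, t n k) / (cube d n).card - L =
      (∑ k ∈ cube d n, (t n k - L)) / (cube d n).card := by
    rw [Finset.sum_sub_distrib, Finset.sum_const, nsmul_eq_mul]
    field_simp
  -- The shell outside the cube of radius `n - m` is bounded crudely by `K + |L|` per site, its
  -- share of the volume being negligible; inside, each term is within `ε / 2`.
  have h2 : |∑ k ∈ cube d n, (t n k - L)| ≤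
      ((cube d n).card - (cube d (n - m)).card) * (K + |L|) + (cube d n).card * (ε / 2) := by
    refine (Finset.abs_sum_le_sum_abs _ _).trans ?_
    rw [← Finset.sum_sdiff hsub]
    refine add_le_add ?_ ?_
    · refine (Finset.sum_le_card_nsmul _ _ (K + |L|) fun k hk => ?_).trans_eq ?_
      · exact (abs_sub _ _).trans (add_le_add_left (hK n k (Finset.mem_sdiff.1 hk).1) _)
      · rw [Finset.card_sdiff_of_subset hsub, nsmul_eq_mul,
          Nat.cast_sub (Finset.card_le_card hsub)]
    · refine (Finset.sum_le_card_nsmul _ _ (ε / 2) fun k hk => hm n k fun i hi => ?_).trans ?_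
      · rw [mem_cube] at hi hk ⊢
        intro j
        have := hi j
        have := hk j
        simp only [Pi.add_apply]
        omega
      · rw [nsmul_eq_mul]
        exact mul_le_mul_of_nonneg_right (Nat.cast_le.2 (Finset.card_le_card hsub))
          (half_pos hε).le
  rw [h1, abs_div, abs_of_pos hc, div_lt_iff₀ hc]
  have h3 : (K + |L|) * (1 - ((cube d (n - m)).card : ℝ) / (cube d n).card) * (cube d n).card =
      ((cube d n).card - (cube d (n - m)).card) * (K + |L|) := by
    field_simp
  nlinarith [mul_lt_mul_of_pos_right hn hc]

end Cube

/-! ### Log-marginals and their entropies -/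

section LogMarginal

variable {S E : Type*} [MeasurableSpace E]

/-- The logarithm of the probability that the spins in `Λ` agree with `ω`. -/
noncomputable def logMarginal (μ : Measure (S → E)) (Λ : Finset S) (ω : S → E) : ℝ :=
  Real.log (marginal μ Λ (Λ.restrict ω))

theorem marginal_restrict (μ : Measure (S → E)) (Λ : Finset S) (ω : S → E) :
    marginal μ Λ (Λ.restrict ω) = μ.real {η | ∀ i ∈ Λ, η i = ω i} := by
  rw [marginal, restrict_preimage_singleton]

theorem logMarginal_congr (μ : Measure (S → E)) {Λ : Finset S} {ω ω' : S → E}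
    (h : ∀ i ∈ Λ, ω i = ω' i) : logMarginal μ Λ ω = logMarginal μ Λ ω' := by
  have : Λ.restrict ω = Λ.restrict ω' := funext fun i => h i i.2
  rw [logMarginal, this, logMarginal]

variable [Finite E]

theorem ae_marginal_restrict_pos (μ : Measure (S → E)) [IsProbabilityMeasure μ] (Λ : Finset S) :
    ∀ᵐ ω ∂μ, 0 < marginal μ Λ (Λ.restrict ω) :=
  ae_measureReal_fiber_pos

variable [DiscreteMeasurableSpace E]

theorem integrable_logMarginal (μ ν : Measure (S → E)) [IsProbabilityMeasure μ] (Λ : Finset S) :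
    Integrable (logMarginal ν Λ) μ :=
  integrable_comp_finite (Finset.measurable_restrict (X := fun _ : S => E) Λ)
    (fun σ => Real.log (marginal ν Λ σ))

theorem integrable_logMarginal_sub (μ ν ν' : Measure (S → E)) [IsProbabilityMeasure μ]
    (Λ Λ' : Finset S) : Integrable (fun ω => logMarginal ν Λ ω - logMarginal ν' Λ' ω) μ :=
  (integrable_logMarginal μ ν Λ).sub (integrable_logMarginal μ ν' Λ')

theorem integral_logMarginal_anti (μ : Measure (S → E)) [IsProbabilityMeasure μ]
    {V V' : Finset S} (h : V ⊆ V') :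
    ∫ ω, logMarginal μ V' ω ∂μ ≤ ∫ ω, logMarginal μ V ω ∂μ := by
  refine integral_mono_ae (integrable_logMarginal μ μ V') (integrable_logMarginal μ μ V) ?_
  filter_upwards [ae_marginal_restrict_pos μ V'] with ω hω
  refine Real.log_le_log hω ?_
  rw [marginal_restrict, marginal_restrict]
  exact measureReal_mono fun η hη i hi => hη i (h hi)

/-- The conditional entropy of a spin decreases with the volume that is conditioned upon. -/
theorem integral_logMarginal_insert_sub_mono [DecidableEq S] (μ : Measure (S → E))
    [IsProbabilityMeasure μ] (k : S) {V V' : Finset S} (h : V ⊆ V') :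
    ∫ ω, logMarginal μ (insert k V) ω ∂μ - ∫ ω, logMarginal μ V ω ∂μ ≤
      ∫ ω, logMarginal μ (insert k V') ω ∂μ - ∫ ω, logMarginal μ V' ω ∂μ := by
  classical
  let _ := Fintype.ofFinite E
  let Y : (S → E) → (V' → E) × E := fun ω => (V'.restrict ω, ω k)
  let Z : (S → E) → (V → E) × E := fun ω => (V.restrict ω, ω k)
  let π : (V' → E) × E → (V → E) × E := fun a => (Finset.restrict₂ (π := fun _ => E) h a.1, a.2)
  have hY : Measurable Y := (Finset.measurable_restrict V').prodMk (measurable_pi_apply k)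
  have hfib : ∀ (U : Finset S) (ω : S → E),
      μ.real ((fun η => (U.restrict (π := fun _ => E) η, η k)) ⁻¹' {(U.restrict ω, ω k)}) =
        marginal μ (insert k U) ((insert k U).restrict ω) := by
    intro U ω
    rw [marginal_restrict]
    congr 1
    ext η
    simp [funext_iff, and_comm]
  -- The reference weight `q` is the law of the spins in `V'` times counting measure for the spin at
  -- `k`, so `log p - log q` is a conditional log-probability. The map `π` forgets `V' \ V`.
  have hcond := sq_sum_abs_sub_le_condRelEntropy π (fun a => μ.real (Y ⁻¹' {a}))
    (fun a => marginal μ V' a.1) (fun b => μ.real (Z ⁻¹' {b})) (fun b => marginal μ V b.1)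
    (fun b => measureReal_preimage_eq_sum (μ := μ) hY (fun a => π a = b))
    (fun b => by
      have h1 := measureReal_preimage_eq_sum (μ := μ) (Finset.measurable_restrict V')
        (fun v => Finset.restrict₂ (π := fun _ => E) h v = b.1)
      refine (show marginal μ V b.1 = _ from h1).trans ?_
      refine Finset.sum_bij (fun v _ => (v, b.2)) ?_ ?_ ?_ ?_
      · intro v hv
        simpa [π, Prod.ext_iff] using hv
      · intro v _ v' _ hvv
        exact (Prod.ext_iff.1 hvv).1
      · rintro ⟨v, e⟩ hv
        have hv' : Finset.restrict₂ (π := fun _ => E) h v = b.1 ∧ e = b.2 := by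
          simpa [π, Prod.ext_iff] using hv
        exact ⟨v, by simpa using hv'.1, by rw [hv'.2]⟩
      · intro v _
        rfl)
    (fun _ => measureReal_nonneg) (fun _ => measureReal_nonneg)
    (by
      have := measureReal_preimage_eq_sum (μ := μ) hY (fun _ => True)
      simpa using this.symm)
    (fun a ha => le_antisymm
      ((measureReal_mono fun η hη => (Prod.ext_iff.1 hη).1).trans ha.le) measureReal_nonneg)
  have h0 := (sq_nonneg _).trans hcond
  rw [← integral_comp_finite (μ := μ) hY (fun a => Real.log (μ.real (Y ⁻¹' {a})) -
    Real.log (marginal μ V' a.1) - (Real.log (μ.real (Z ⁻¹' {π a})) -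
      Real.log (marginal μ V (π a).1)))] at h0
  have h1 : ∀ ω, Real.log (μ.real (Y ⁻¹' {Y ω})) - Real.log (marginal μ V' (Y ω).1) -
      (Real.log (μ.real (Z ⁻¹' {π (Y ω)})) - Real.log (marginal μ V (π (Y ω)).1)) =
      (logMarginal μ (insert k V') ω - logMarginal μ V' ω) -
      (logMarginal μ (insert k V) ω - logMarginal μ V ω) := by
    intro ω
    have e1 := hfib V' ω
    have e2 := hfib V ω
    simp only [logMarginal]
    rw [← e1, ← e2]
    rfl
  simp only [h1] at h0
  have hi := integrable_logMarginal μ μ (S := S) (E := E)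
  rw [integral_sub (integrable_logMarginal_sub μ μ μ _ _)
    (integrable_logMarginal_sub μ μ μ _ _), integral_sub (hi _) (hi _),
    integral_sub (hi _) (hi _)] at h0
  linarith

theorem sq_sum_abs_sub_marginal_le {E : Type*} [MeasurableSpace E] [Fintype E] [DecidableEq S]
    [DiscreteMeasurableSpace E] (μ ν : Measure (S → E))
    [IsProbabilityMeasure μ] [IsProbabilityMeasure ν] {V D : Finset S} (h : V ⊆ D)
    (hν : ∀ σ, 0 < marginal ν D σ) :
    (∑ σ, |marginal μ D σ - marginal μ V (Finset.restrict₂ (π := fun _ => E) h σ) * marginal ν D σ /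
        marginal ν V (Finset.restrict₂ (π := fun _ => E) h σ)|) ^ 2 ≤
      4 * (∫ ω, (logMarginal μ D ω - logMarginal ν D ω) ∂μ -
        ∫ ω, (logMarginal μ V ω - logMarginal ν V ω) ∂μ) := by
  classical
  have hD := Finset.measurable_restrict (X := fun _ : S => E) D
  refine (sq_sum_abs_sub_le_condRelEntropy (Finset.restrict₂ (π := fun _ => E) h) (marginal μ D) (marginal ν D)
    (marginal μ V) (marginal ν V)
    (fun b => measureReal_preimage_eq_sum (μ := μ) hD (fun a => Finset.restrict₂ (π := fun _ => E) h a = b))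
    (fun b => measureReal_preimage_eq_sum (μ := ν) hD (fun a => Finset.restrict₂ (π := fun _ => E) h a = b))
    (fun _ => measureReal_nonneg) (fun _ => measureReal_nonneg)
    (by
      have := measureReal_preimage_eq_sum (μ := μ) hD (fun _ => True)
      simpa [marginal] using this.symm) (fun a ha => absurd ha (hν a).ne')).trans_eq ?_
  congr 1
  rw [← integral_sub (integrable_logMarginal_sub μ μ ν _ _)
    (integrable_logMarginal_sub μ μ ν _ _)]
  exact (integral_comp_finite (μ := μ) hD (fun a => Real.log (marginal μ D a) -
    Real.log (marginal ν D a) - (Real.log (marginal μ V (Finset.restrict₂ (π := fun _ => E) h a)) -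
      Real.log (marginal ν V (Finset.restrict₂ (π := fun _ => E) h a))))).symm

theorem relEntropy_eq_ofReal {d : ℕ} {E : Type*} [MeasurableSpace E] [Finite E]
    [DiscreteMeasurableSpace E] (μ ν : Measure ((Fin d → ℤ) → E))
    [IsProbabilityMeasure μ] [IsProbabilityMeasure ν] {Λ : Finset (Fin d → ℤ)}
    (hν : ∀ σ, 0 < marginal ν Λ σ) :
    relEntropy Λ μ ν =
      ENNReal.ofReal (∫ ω, (logMarginal μ Λ ω - logMarginal ν Λ ω) ∂μ) := by
  have hΛ := Finset.measurable_restrict (X := fun _ : Fin d → ℤ => E) Λ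
  have := Measure.isProbabilityMeasure_map (μ := μ) hΛ.aemeasurable
  have := Measure.isProbabilityMeasure_map (μ := ν) hΛ.aemeasurable
  have hreal : ∀ (ρ : Measure ((Fin d → ℤ) → E)) σ,
      (ρ.map Λ.restrict).real {σ} = marginal ρ Λ σ := fun ρ σ =>
    map_measureReal_apply hΛ (measurableSet_singleton σ)
  rw [relEntropy, klDiv_eq_ofReal_integral (fun σ => by rw [hreal]; exact hν σ)]
  simp only [hreal]
  rw [integral_map hΛ.aemeasurable Integrable.of_finite.aestronglyMeasurable]
  rfl

end LogMarginal

/-! ### Translation invariance -/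

section Shift

variable {d : ℕ} {E : Type*} [MeasurableSpace E]

theorem measurable_shift (x : Fin d → ℤ) : Measurable (shift (E := E) x) :=
  measurable_pi_lambda _ fun i => measurable_pi_apply (i - x)

theorem logMarginal_map_shift {μ : Measure ((Fin d → ℤ) → E)} (hμ : IsInvariantProb μ)
    [Finite E] [DiscreteMeasurableSpace E]
    (x : Fin d → ℤ) (Λ : Finset (Fin d → ℤ)) (ω : (Fin d → ℤ) → E) :
    logMarginal μ (Λ.map (addRightEmbedding x)) (shift x ω) = logMarginal μ Λ ω := by
  rw [logMarginal, logMarginal, marginal_restrict, marginal_restrict]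
  congr 1
  conv_lhs => rw [← hμ.2 x]
  rw [map_measureReal_apply (measurable_shift x)]
  · congr 1
    ext η
    simp [shift]
  · rw [← restrict_preimage_singleton]
    exact Finset.measurable_restrict _ (measurableSet_singleton _)

theorem IsInvariantProb.integral_comp_shift {μ : Measure ((Fin d → ℤ) → E)}
    (hμ : IsInvariantProb μ) (x : Fin d → ℤ) {f : ((Fin d → ℤ) → E) → ℝ}
    (hf : AEStronglyMeasurable f μ) :
    ∫ ω, f (shift x ω) ∂μ = ∫ ω, f ω ∂μ := by
  conv_rhs => rw [← hμ.2 x]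
  rw [integral_map (measurable_shift x).aemeasurable (by rwa [hμ.2 x])]

end Shift

/-! ### Existence of the specific entropy -/

section EntropyDensity

theorem logMarginal_empty {S E : Type*} [MeasurableSpace E] (μ : Measure (S → E)) [IsProbabilityMeasure μ] (ω : S → E) :
    logMarginal μ ∅ ω = 0 := by
  simp [logMarginal, marginal_restrict]

variable {d : ℕ}

/-- The lexicographic order on the lattice. -/
def LexLT (i k : Fin d → ℤ) : Prop := toLex i < toLex k

theorem lexLT_add_right_iff (i j k : Fin d → ℤ) : LexLT (i + k) (j + k) ↔ LexLT i j :=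
  add_lt_add_iff_right (toLex k)

theorem lexLT_add_iff (i k : Fin d → ℤ) : LexLT (i + k) k ↔ LexLT i 0 := by
  simpa using lexLT_add_right_iff i 0 k

open scoped Classical in
theorem sum_lex_increment_eq_sub (F : Finset (Fin d → ℤ) → ℝ) (Λ : Finset (Fin d → ℤ)) :
    ∑ k ∈ Λ, (F (insert k {i ∈ Λ | LexLT i k}) - F {i ∈ Λ | LexLT i k}) = F Λ - F ∅ :=
  sum_increment_eq_sub (toLex : (Fin d → ℤ) → Lex (Fin d → ℤ)) toLex.injective LexLT
    (fun _ _ => Iff.rfl) F Λ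

variable {E : Type*} [MeasurableSpace E] [Finite E] [DiscreteMeasurableSpace E]

theorem integral_logMarginal_map {μ : Measure ((Fin d → ℤ) → E)} (hμ : IsInvariantProb μ)
    (x : Fin d → ℤ) (Λ : Finset (Fin d → ℤ)) :
    ∫ ω, logMarginal μ (Λ.map (addRightEmbedding x)) ω ∂μ = ∫ ω, logMarginal μ Λ ω ∂μ := by
  have := hμ.1
  rw [← hμ.integral_comp_shift x (integrable_logMarginal μ μ _).aestronglyMeasurable]
  simp only [logMarginal_map_shift hμ]

/-- The limit is minus the specific entropy of `μ`. -/
theorem exists_tendsto_integral_logMarginal {μ : Measure ((Fin d → ℤ) → E)}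
    (hμ : IsInvariantProb μ) :
    ∃ s : ℝ, Tendsto (fun n => (∫ ω, logMarginal μ (cube d n) ω ∂μ) / (cube d n).card)
      atTop (𝓝 s) := by
  classical
  have := hμ.1
  let L : Finset (Fin d → ℤ) → ℝ := fun V => ∫ ω, logMarginal μ V ω ∂μ
  -- Minus the conditional entropy of the spin at the origin given the spins in `V`.
  let a : Finset (Fin d → ℤ) → ℝ := fun V => L (insert 0 V) - L V
  have ha : Monotone a := fun V V' h => integral_logMarginal_insert_sub_mono μ 0 h
  have ha0 : ∀ V, a V ≤ 0 := fun V =>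
    sub_nonpos.2 (integral_logMarginal_anti μ (Finset.subset_insert _ _))
  let R : Set ℝ := a '' {V | ∀ i ∈ V, LexLT i 0}
  have hR : BddAbove R := ⟨0, by rintro _ ⟨V, -, rfl⟩; exact ha0 V⟩
  have hRne : R.Nonempty := ⟨a ∅, ∅, by simp, rfl⟩
  -- The part of the cube that precedes `k`, translated so that `k` becomes the origin.
  let V : ℕ → (Fin d → ℤ) → Finset (Fin d → ℤ) := fun n k =>
    ({i ∈ cube d n | LexLT i k}).map (addRightEmbedding (-k))
  have hVmem : ∀ n k i, i ∈ V n k ↔ i + k ∈ cube d n ∧ LexLT i 0 := by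
    intro n k i
    simp only [V, Finset.mem_map, Finset.mem_filter, addRightEmbedding_apply]
    constructor
    · rintro ⟨j, ⟨hj, hjk⟩, rfl⟩
      rw [neg_add_cancel_right]
      refine ⟨hj, ?_⟩
      rw [← lexLT_add_iff _ k]
      simpa using hjk
    · rintro ⟨h1, h2⟩
      exact ⟨i + k, ⟨h1, (lexLT_add_iff _ k).2 h2⟩, by simp⟩
  have ht : ∀ n k, L (insert k {i ∈ cube d n | LexLT i k}) -
      L {i ∈ cube d n | LexLT i k} = a (V n k) := by
    intro n k
    have h0 : insert 0 (V n k) =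
        (insert k {i ∈ cube d n | LexLT i k}).map (addRightEmbedding (-k)) := by
      simp [V, Finset.map_insert]
    simp only [a, h0]
    simp only [L, V]
    rw [integral_logMarginal_map hμ, integral_logMarginal_map hμ]
  -- The supremum is over finite subsets of the past of the origin; one that nearly attains it lies
  -- in `V n k` for every `k` far from the boundary.
  refine ⟨sSup R, ?_⟩
  have hsum : ∀ n, L (cube d n) = ∑ k ∈ cube d n, a (V n k) := by
    intro n
    have h := sum_lex_increment_eq_sub L (cube d n)
    have h1 : L ∅ = 0 := by simp [L, logMarginal_empty]
    rw [h1, sub_zero] at h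
    rw [← h]
    exact Finset.sum_congr rfl fun k _ => ht n k
  change Tendsto (fun n => L (cube d n) / (cube d n).card) atTop _
  simp only [hsum]
  refine tendsto_cube_average (K := |a ∅|) (fun n k _ => ?_) fun ε hε => ?_
  · have h1 := ha (Finset.empty_subset (V n k))
    rw [abs_of_nonpos (ha0 _), abs_of_nonpos (ha0 _)]
    exact neg_le_neg h1
  · obtain ⟨_, ⟨V₀, hV₀, rfl⟩, hlt⟩ := exists_lt_of_lt_csSup hRne (sub_lt_self (sSup R) hε)
    obtain ⟨m, hm⟩ := exists_subset_cube V₀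
    refine ⟨m, fun n k hk => ?_⟩
    have h1 : a V₀ ≤ a (V n k) := ha fun i hi => (hVmem n k i).2 ⟨hk i (hm hi), hV₀ i hi⟩
    have h2 : a (V n k) ≤ sSup R := le_csSup hR ⟨V n k, fun i hi => ((hVmem n k i).1 hi).2, rfl⟩
    rw [abs_le]
    constructor <;> linarith

end EntropyDensity

/-! ### One-site conditional probabilities -/

section SingleSite

variable {S E : Type*} [MeasurableSpace E] {γ : Specification S E}

/-- The logarithm of the conditional probability of the spin at `k` given all the others. -/
noncomputable def logSite (γ : Specification S E) (k : S) (ζ : S → E) : ℝ :=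
  Real.log ((γ.ker {k} ζ).real {η | η k = ζ k})

theorem abs_logSite_le {k : S} {δ : ℝ} (hδ : 0 < δ)
    (hle : ∀ a ζ, δ ≤ (γ.ker {k} ζ).real {η | η k = a}) (ζ : S → E) :
    |logSite γ k ζ| ≤ -Real.log δ := by
  have h1 := Real.log_le_log hδ (hle (ζ k) ζ)
  have h2 := Real.log_nonpos measureReal_nonneg (γ.measureReal_le_one {k} {η | η k = ζ k} ζ)
  rw [logSite, abs_of_nonpos h2]
  exact neg_le_neg h1

variable [Finite E] [DiscreteMeasurableSpace E]

theorem measurable_logSite (γ : Specification S E) (k : S) : Measurable (logSite γ k) := by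
  have := γ.isMarkov {k}
  have ht : MeasurableSet {p : (S → E) × (S → E) | p.2 k = p.1 k} :=
    measurableSet_eq_fun ((measurable_pi_apply k).comp measurable_snd)
      ((measurable_pi_apply k).comp measurable_fst)
  exact (Kernel.measurable_kernel_prodMk_left (κ := γ.ker {k}) ht).ennreal_toReal.log

theorem exists_pos_le_site (hql : γ.IsQuasilocal) (hnn : γ.IsNonNull) (k : S) :
    ∃ δ : ℝ, 0 < δ ∧ ∀ a ζ, δ ≤ (γ.ker {k} ζ).real {η | η k = a} := by
  have h : ∀ a, ∃ δ : ℝ, 0 < δ ∧ ∀ ζ, δ ≤ (γ.ker {k} ζ).real {η | η k = a} := by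
    intro a
    refine hql.exists_pos_le {k} {k} {σ | σ ⟨k, Finset.mem_singleton_self k⟩ = a} fun ω => ?_
    have := γ.isMarkov {k}
    have h1 := hnn {k} (fun _ => a) ω
    simp only [Finset.mem_singleton, forall_eq] at h1
    exact ENNReal.toReal_pos h1.ne' (measure_ne_top _ _)
  choose δ hδ hle using h
  rcases isEmpty_or_nonempty E with hE | hE
  · exact ⟨1, one_pos, fun a => isEmptyElim a⟩
  · obtain ⟨a₀, ha₀⟩ := Finite.exists_min δ
    exact ⟨δ a₀, hδ a₀, fun a ζ => (ha₀ a).trans (hle a ζ)⟩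

theorem exists_finset_site (hql : γ.IsQuasilocal) (k : S) {ε : ℝ} (hε : 0 < ε) :
    ∃ W : Finset S, ∀ a (ω ω' : S → E), (∀ i ∈ W, i ≠ k → ω i = ω' i) →
      |(γ.ker {k} ω).real {η | η k = a} - (γ.ker {k} ω').real {η | η k = a}| ≤ ε := by
  classical
  let _ := Fintype.ofFinite E
  have h := fun a : E => hql.exists_finset {k} {k}
    {σ | σ ⟨k, Finset.mem_singleton_self k⟩ = a} hε
  choose W hW using h
  refine ⟨Finset.univ.biUnion W, fun a ω ω' hω => ?_⟩
  refine hW a ω ω' fun i hi hik => hω i ?_ (by simpa using hik)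
  exact Finset.mem_biUnion.2 ⟨a, Finset.mem_univ a, hi⟩

variable {ν : Measure (S → E)}

theorem Specification.IsDLR.marginal_eq_setIntegral [DecidableEq S] (hν : γ.IsDLR ν) {k : S}
    {D : Finset S} (hk : k ∈ D) (ζ : S → E) :
    marginal ν D (D.restrict ζ) =
      ∫ η in {η | ∀ i ∈ D.erase k, η i = ζ i}, (γ.ker {k} η).real {η | η k = ζ k} ∂ν := by
  have hA : MeasurableSet {η : S → E | η k = ζ k} :=
    (measurable_pi_apply (X := fun _ : S => E) k) (measurableSet_singleton (ζ k))
  rw [← hν.measureReal_inter {k} hA, marginal_restrict]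
  · congr 1
    ext η
    simp only [Set.mem_inter_iff, Set.mem_ofPred_eq, Finset.mem_erase]
    constructor
    · exact fun h => ⟨h k hk, fun i hi => h i hi.2⟩
    · rintro ⟨h1, h2⟩ i hi
      by_cases hik : i = k
      · rwa [hik]
      · exact h2 i ⟨hik, hi⟩
  · rw [← restrict_preimage_singleton]
    refine cylinderEvents_mono ?_ _ (measurable_restrict_cylinderEvents_coe _
      (measurableSet_singleton _))
    intro i hi
    simpa using (Finset.mem_erase.1 hi).1

/-- The conditional probability of a spin given finitely many others lies between any bounds on
its conditional probability given all others. -/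
theorem Specification.IsDLR.marginal_mem_Icc [DecidableEq S] (hν : γ.IsDLR ν) {k : S}
    {D : Finset S} (hk : k ∈ D) (ζ : S → E) {l u : ℝ}
    (h : ∀ η, (∀ i ∈ D.erase k, η i = ζ i) → (γ.ker {k} η).real {η | η k = ζ k} ∈ Set.Icc l u) :
    marginal ν D (D.restrict ζ) ∈
      Set.Icc (l * marginal ν (D.erase k) ((D.erase k).restrict ζ))
        (u * marginal ν (D.erase k) ((D.erase k).restrict ζ)) := by
  have := hν.1
  have hm : MeasurableSet {η : S → E | ∀ i ∈ D.erase k, η i = ζ i} := by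
    rw [← restrict_preimage_singleton]
    exact Finset.measurable_restrict _ (measurableSet_singleton _)
  have hi := (γ.integrable_measureReal ν {k}
    (measurable_pi_apply k (measurableSet_singleton (ζ k)))).integrableOn
      (s := {η : S → E | ∀ i ∈ D.erase k, η i = ζ i})
  rw [hν.marginal_eq_setIntegral hk, marginal_restrict]
  constructor
  · have h1 := setIntegral_mono_on (integrableOn_const (C := l)) hi hm fun η hη => (h η hη).1
    rw [setIntegral_const, smul_eq_mul, mul_comm] at h1
    exact h1
  · have h1 := setIntegral_mono_on hi (integrableOn_const (C := u)) hm fun η hη => (h η hη).2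
    rw [setIntegral_const, smul_eq_mul, mul_comm] at h1
    exact h1

theorem abs_log_sub_log_le {x y δ : ℝ} (hδ : 0 < δ) (hx : δ ≤ x) (hy : δ ≤ y) :
    |Real.log x - Real.log y| ≤ |x - y| / δ := by
  have key : ∀ x y : ℝ, δ ≤ x → δ ≤ y → Real.log x - Real.log y ≤ |x - y| / δ := by
    intro x y hx hy
    have hx0 := hδ.trans_le hx
    have hy0 := hδ.trans_le hy
    rw [← Real.log_div hx0.ne' hy0.ne']
    refine (Real.log_le_sub_one_of_pos (div_pos hx0 hy0)).trans ?_
    rw [div_sub_one hy0.ne']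
    exact (div_le_div_of_nonneg_right (le_abs_self _) hy0.le).trans
      (div_le_div_of_nonneg_left (abs_nonneg _) hδ hy)
  rw [abs_le]
  constructor
  · have := key y x hy hx
    rw [abs_sub_comm] at this
    linarith
  · exact key x y hx hy

theorem Specification.IsDLR.abs_logMarginal_sub_le [DecidableEq S] (hν : γ.IsDLR ν)
    (hnn : γ.IsNonNull) {k : S} {δ : ℝ} (hδ : 0 < δ)
    (hle : ∀ a ζ, δ ≤ (γ.ker {k} ζ).real {η | η k = a}) {D : Finset S} (hk : k ∈ D) (ζ : S → E) :
    |logMarginal ν D ζ - logMarginal ν (D.erase k) ζ| ≤ -Real.log δ := by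
  have hp := hν.marginal_pos hnn (D.erase k) ((D.erase k).restrict ζ)
  have hp' := hν.marginal_pos hnn D (D.restrict ζ)
  have h := hν.marginal_mem_Icc hk ζ (l := δ) (u := 1)
    fun η _ => ⟨hle _ _, γ.measureReal_le_one _ _ _⟩
  have h1 := Real.log_le_log (mul_pos hδ hp) h.1
  have h2 := Real.log_le_log hp' h.2
  rw [Real.log_mul hδ.ne' hp.ne'] at h1
  rw [one_mul] at h2
  simp only [logMarginal]
  rw [abs_of_nonpos (by linarith)]
  linarith

theorem Specification.IsDLR.abs_logMarginal_sub_sub_logSite_le [DecidableEq S] (hν : γ.IsDLR ν)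
    (hnn : γ.IsNonNull) {k : S} {δ ε : ℝ} (hδ : 0 < δ)
    (hle : ∀ a ζ, δ ≤ (γ.ker {k} ζ).real {η | η k = a}) {W D : Finset S}
    (hW : ∀ a (ω ω' : S → E), (∀ i ∈ W, i ≠ k → ω i = ω' i) →
      |(γ.ker {k} ω).real {η | η k = a} - (γ.ker {k} ω').real {η | η k = a}| ≤ ε)
    (hk : k ∈ D) (hWD : W ⊆ D) (ζ : S → E) :
    |logMarginal ν D ζ - logMarginal ν (D.erase k) ζ - logSite γ k ζ| ≤ ε / δ := by
  have hp := hν.marginal_pos hnn (D.erase k) ((D.erase k).restrict ζ)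
  have hp' := hν.marginal_pos hnn D (D.restrict ζ)
  -- The maximum with `δ` keeps the conditional probability in the range where `log` is Lipschitz
  -- with constant `1/δ`.
  have h := hν.marginal_mem_Icc hk ζ (l := max δ ((γ.ker {k} ζ).real {η | η k = ζ k} - ε))
    (u := (γ.ker {k} ζ).real {η | η k = ζ k} + ε) fun η hη => by
      have h1 := abs_le.1 (hW (ζ k) η ζ fun i hi hik =>
        hη i (Finset.mem_erase.2 ⟨hik, hWD hi⟩))
      exact ⟨max_le (hle _ _) (by linarith), by linarith⟩
  rw [Set.mem_Icc, ← le_div_iff₀ hp, ← div_le_iff₀ hp] at h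
  have h2 := abs_log_sub_log_le hδ ((le_max_left _ _).trans h.1) (hle (ζ k) ζ)
  rw [Real.log_div hp'.ne' hp.ne'] at h2
  refine h2.trans (div_le_div_of_nonneg_right ?_ hδ.le)
  rw [abs_le]
  have h3 := (le_max_right _ _).trans h.1
  constructor <;> linarith [h.2]

end SingleSite

/-! ### The energy density -/

section EnergyDensity

variable {d : ℕ} {E : Type*}

open scoped Classical in
/-- The configuration `ω` up to `k` in lexicographic order, and `e` beyond. -/
noncomputable def cutLE (e : E) (k : Fin d → ℤ) (ω : (Fin d → ℤ) → E) : (Fin d → ℤ) → E :=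
  fun i => if LexLT i k ∨ i = k then ω i else e

open scoped Classical in
/-- The configuration `ω` before `k` in lexicographic order, and `e` from `k` on. -/
noncomputable def cutLT (e : E) (k : Fin d → ℤ) (ω : (Fin d → ℤ) → E) : (Fin d → ℤ) → E :=
  fun i => if LexLT i k then ω i else e

theorem shift_cutLE (e : E) (k : Fin d → ℤ) (ω : (Fin d → ℤ) → E) :
    shift (-k) (cutLE e k ω) = cutLE e 0 (shift (-k) ω) := by
  funext i
  classical
  refine if_congr ?_ rfl rfl
  rw [sub_neg_eq_add, lexLT_add_iff, add_eq_right]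

theorem shift_cutLT (e : E) (k : Fin d → ℤ) (ω : (Fin d → ℤ) → E) :
    shift (-k) (cutLT e k ω) = cutLT e 0 (shift (-k) ω) := by
  funext i
  classical
  refine if_congr ?_ rfl rfl
  rw [sub_neg_eq_add, lexLT_add_iff]

variable [MeasurableSpace E]

theorem measurable_cutLE (e : E) (k : Fin d → ℤ) : Measurable (cutLE e k) :=
  measurable_pi_lambda _ fun i => by
    unfold cutLE
    split_ifs
    · exact measurable_pi_apply i
    · exact measurable_const

theorem measurable_cutLT (e : E) (k : Fin d → ℤ) : Measurable (cutLT e k) :=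
  measurable_pi_lambda _ fun i => by
    unfold cutLT
    split_ifs
    · exact measurable_pi_apply i
    · exact measurable_const

/-- The contribution of the origin to the energy relative to the constant configuration `e`. -/
noncomputable def siteEnergy (γ : Specification (Fin d → ℤ) E) (e : E)
    (ω : (Fin d → ℤ) → E) : ℝ :=
  logSite γ 0 (cutLE e 0 ω) - logSite γ 0 (cutLT e 0 ω)

variable [Finite E] [DiscreteMeasurableSpace E] {γ : Specification (Fin d → ℤ) E}
  {μ ν : Measure ((Fin d → ℤ) → E)}

/-- Switching from `e` to `ω` in lexicographic order telescopes the difference. Invariance of `μ`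
and `ν` moves each switch to the origin, with the cube translated accordingly; the limiting
integrand depends on `ν` only through `γ`. -/
theorem tendsto_integral_logMarginal_sub (hql : γ.IsQuasilocal) (hnn : γ.IsNonNull)
    (hν : γ.IsInvariantDLR ν) (hμ : IsInvariantProb μ) (e : E) :
    Tendsto (fun n => (∫ ω, logMarginal ν (cube d n) ω ∂μ -
        logMarginal ν (cube d n) (fun _ => e)) / (cube d n).card)
      atTop (𝓝 (∫ ω, siteEnergy γ e ω ∂μ)) := by
  classical
  have := hμ.1
  obtain ⟨δ, hδ, hle⟩ := exists_pos_le_site hql hnn (0 : Fin d → ℤ)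
  have hK := abs_logSite_le hδ hle
  have hlm : ∀ (D : Finset (Fin d → ℤ)) (f : ((Fin d → ℤ) → E) → ((Fin d → ℤ) → E)),
      Measurable f → Integrable (fun ω => logMarginal ν D (f ω)) μ := fun D f hf =>
    integrable_comp_finite ((Finset.measurable_restrict D).comp hf)
      (fun σ => Real.log (marginal ν D σ))
  have hgi : Integrable (siteEnergy γ e) μ := by
    refine Integrable.of_bound (C := -Real.log δ + -Real.log δ)
      (((measurable_logSite γ 0).comp (measurable_cutLE e 0)).sub
        ((measurable_logSite γ 0).comp (measurable_cutLT e 0))).aestronglyMeasurable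
      (Eventually.of_forall fun ω => ?_)
    exact (abs_sub _ _).trans (add_le_add (hK _) (hK _))
  let ψ : Finset (Fin d → ℤ) → ((Fin d → ℤ) → E) → ℝ := fun D ω =>
    logMarginal ν D (cutLE e 0 ω) - logMarginal ν D (cutLT e 0 ω)
  have hψi : ∀ D, Integrable (ψ D) μ := fun D =>
    (hlm D _ (measurable_cutLE e 0)).sub (hlm D _ (measurable_cutLT e 0))
  -- The two configurations differ only at the origin, so the terms with the origin erased cancel
  -- and each bracket is the logarithm of a conditional probability.
  have hψ : ∀ D ω, ψ D ω = (logMarginal ν D (cutLE e 0 ω) -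
      logMarginal ν (D.erase 0) (cutLE e 0 ω)) - (logMarginal ν D (cutLT e 0 ω) -
      logMarginal ν (D.erase 0) (cutLT e 0 ω)) := by
    intro D ω
    have h : logMarginal ν (D.erase 0) (cutLE e 0 ω) =
        logMarginal ν (D.erase 0) (cutLT e 0 ω) := by
      refine logMarginal_congr ν fun i hi => ?_
      simp [cutLE, cutLT, (Finset.mem_erase.1 hi).1]
    simp only [ψ]
    linarith
  let t : ℕ → (Fin d → ℤ) → ℝ := fun n k =>
    ∫ ω, ψ ((cube d n).map (addRightEmbedding (-k))) ω ∂μ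
  have ht : ∀ n k, t n k = ∫ ω, (logMarginal ν (cube d n) (cutLE e k ω) -
      logMarginal ν (cube d n) (cutLT e k ω)) ∂μ := by
    intro n k
    simp only [t]
    rw [← hμ.integral_comp_shift (-k) (hψi _).aestronglyMeasurable]
    simp only [ψ, ← shift_cutLE, ← shift_cutLT, logMarginal_map_shift hν.2]
  have hsum : ∀ n, ∫ ω, logMarginal ν (cube d n) ω ∂μ - logMarginal ν (cube d n) (fun _ => e) =
      ∑ k ∈ cube d n, t n k := by
    intro n
    simp only [ht]
    have hi : ∀ k ∈ cube d n, Integrable (fun ω => logMarginal ν (cube d n) (cutLE e k ω) -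
        logMarginal ν (cube d n) (cutLT e k ω)) μ := fun k _ =>
      (hlm _ _ (measurable_cutLE e k)).sub (hlm _ _ (measurable_cutLT e k))
    rw [← integral_finsetSum _ hi]
    have h1 : ∀ ω : (Fin d → ℤ) → E, ∑ k ∈ cube d n, (logMarginal ν (cube d n) (cutLE e k ω) -
        logMarginal ν (cube d n) (cutLT e k ω)) =
        logMarginal ν (cube d n) ω - logMarginal ν (cube d n) (fun _ => e) := by
      intro ω
      have h2 := sum_lex_increment_eq_sub
        (fun V => logMarginal ν (cube d n) (V.piecewise ω fun _ => e)) (cube d n)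
      have h3 : logMarginal ν (cube d n) ((cube d n).piecewise ω fun _ => e) =
          logMarginal ν (cube d n) ω :=
        logMarginal_congr ν fun i hi => by simp [hi]
      rw [h3, Finset.piecewise_empty] at h2
      rw [← h2]
      refine Finset.sum_congr rfl fun k hk => ?_
      congr 1
      · refine logMarginal_congr ν fun i hi => ?_
        simp [cutLE, Finset.piecewise, hi, or_comm]
      · refine logMarginal_congr ν fun i hi => ?_
        simp [cutLT, Finset.piecewise, hi]
    simp only [h1]
    rw [integral_sub (integrable_logMarginal μ ν _) (integrable_const _)]
    simp
  simp only [hsum]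
  refine tendsto_cube_average (K := -Real.log δ + -Real.log δ) (fun n k hk => ?_) fun ε hε => ?_
  · have h0 : (0 : Fin d → ℤ) ∈ (cube d n).map (addRightEmbedding (-k)) :=
      Finset.mem_map.2 ⟨k, hk, by simp⟩
    have h1 : ∀ ω, ‖ψ ((cube d n).map (addRightEmbedding (-k))) ω‖ ≤
        -Real.log δ + -Real.log δ := by
      intro ω
      rw [hψ]
      exact (abs_sub _ _).trans (add_le_add (hν.1.abs_logMarginal_sub_le hnn hδ hle h0 _)
        (hν.1.abs_logMarginal_sub_le hnn hδ hle h0 _))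
    have h2 := norm_integral_le_of_norm_le_const (μ := μ) (Eventually.of_forall h1)
    simpa using h2
  · obtain ⟨W, hW⟩ := exists_finset_site hql (0 : Fin d → ℤ)
      (show 0 < ε * δ / 2 by positivity)
    obtain ⟨m, hm⟩ := exists_subset_cube (insert 0 W)
    refine ⟨m, fun n k hk => ?_⟩
    have hsub : insert 0 W ⊆ (cube d n).map (addRightEmbedding (-k)) := fun i hi =>
      Finset.mem_map.2 ⟨i + k, hk i (hm hi), by simp⟩
    have h0 := hsub (Finset.mem_insert_self 0 W)
    have hW0 := (Finset.subset_insert 0 W).trans hsub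
    have h1 : ∀ ω, ‖ψ ((cube d n).map (addRightEmbedding (-k))) ω - siteEnergy γ e ω‖ ≤ ε := by
      intro ω
      have h2 := hν.1.abs_logMarginal_sub_sub_logSite_le hnn hδ hle hW h0 hW0 (cutLE e 0 ω)
      have h3 := hν.1.abs_logMarginal_sub_sub_logSite_le hnn hδ hle hW h0 hW0 (cutLT e 0 ω)
      have h4 : ε * δ / 2 / δ = ε / 2 := by field_simp
      rw [h4, abs_le] at h2 h3
      rw [hψ, siteEnergy, Real.norm_eq_abs, abs_le]
      constructor <;> linarith [h2.1, h2.2, h3.1, h3.2]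
    simp only [t]
    rw [← integral_sub (hψi _) hgi]
    have h2 := norm_integral_le_of_norm_le_const (μ := μ) (Eventually.of_forall h1)
    simpa using h2

end EnergyDensity

/-! ### Relative entropy and resampling -/

section MarginalRelEntropy

variable {S E : Type*} [MeasurableSpace E]

/-- The relative entropy in a finite volume, as a real number. -/
noncomputable def marginalRelEntropy (μ ν : Measure (S → E)) (Λ : Finset S) : ℝ :=
  ∫ ω, (logMarginal μ Λ ω - logMarginal ν Λ ω) ∂μ

variable {μ ν : Measure (S → E)} [IsProbabilityMeasure μ] [IsProbabilityMeasure ν]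

theorem marginalRelEntropy_empty : marginalRelEntropy μ ν ∅ = 0 := by
  simp [marginalRelEntropy, logMarginal_empty]

variable [Finite E] [DiscreteMeasurableSpace E]

theorem marginalRelEntropy_mono (hν : ∀ (Λ : Finset S) σ, 0 < marginal ν Λ σ) :
    Monotone (marginalRelEntropy μ ν) := by
  classical
  intro V D h
  let _ := Fintype.ofFinite E
  have h1 := (sq_nonneg _).trans (sq_sum_abs_sub_marginal_le μ ν h (hν D))
  simp only [marginalRelEntropy]
  linarith

/-- If the relative entropies in `D` and `D \ Λ` are close to each other, then resampling in `Λ`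
according to the specification of `ν` has little effect on `μ`. -/
theorem abs_measureReal_sub_integral_le [DecidableEq S] {γ : Specification S E}
    (hν : γ.IsDLR ν) (hpos : ∀ (Λ : Finset S) σ, 0 < marginal ν Λ σ)
    {Λ Δ D : Finset S} (T : Set (Δ → E)) (hΔ : Δ ⊆ D) {ε : ℝ} (hε : 0 ≤ ε)
    (hosc : ∀ ω ω' : S → E, (∀ i ∈ D, i ∉ Λ → ω i = ω' i) →
      |(γ.ker Λ ω).real (Δ.restrict ⁻¹' T) - (γ.ker Λ ω').real (Δ.restrict ⁻¹' T)| ≤ ε)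
    (hrel : marginalRelEntropy μ ν D - marginalRelEntropy μ ν (D \ Λ) ≤ ε ^ 2) :
    |μ.real (Δ.restrict ⁻¹' T) - ∫ ω, (γ.ker Λ ω).real (Δ.restrict ⁻¹' T) ∂μ| ≤ 4 * ε := by
  classical
  let _ := Fintype.ofFinite E
  obtain ⟨ω₀⟩ : Nonempty (S → E) := nonempty_of_isProbabilityMeasure ν
  set A : Set (S → E) := Δ.restrict ⁻¹' T with hA
  have hAm : MeasurableSet A := Finset.measurable_restrict Δ MeasurableSet.of_discrete
  set V := D \ Λ with hV
  have hVD : V ⊆ D := Finset.sdiff_subset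
  have hDm := Finset.measurable_restrict (X := fun _ : S => E) D
  have hVm := Finset.measurable_restrict (X := fun _ : S => E) V
  let π : (D → E) → (V → E) := Finset.restrict₂ (π := fun _ => E) hVD
  let P : (D → E) → Prop := fun σ => Finset.restrict₂ (π := fun _ => E) hΔ σ ∈ T
  let m : (D → E) → ℝ := fun σ => marginal μ V (π σ) * marginal ν D σ / marginal ν V (π σ)
  -- The weight `m` has the `V`-marginal of `μ` and the conditional law of `ν` given `V`. The total
  -- error `4 * ε` is `2 * ε` from this step and `ε` each from replacing that conditional law by
  -- `γ_Λ` and from freezing the boundary condition.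
  have hdist : ∑ σ, |marginal μ D σ - m σ| ≤ 2 * ε := by
    refine abs_le_of_sq_le_sq' ?_ (by positivity) |>.2
    refine (sq_sum_abs_sub_marginal_le μ ν hVD (hpos D)).trans ?_
    simp only [marginalRelEntropy] at hrel
    nlinarith
  have hμA : μ.real A = ∑ σ with P σ, marginal μ D σ :=
    measureReal_preimage_eq_sum (μ := μ) hDm P
  have h1 : |μ.real A - ∑ σ with P σ, m σ| ≤ 2 * ε := by
    rw [hμA, ← Finset.sum_sub_distrib]
    refine (Finset.abs_sum_le_sum_abs _ _).trans (le_trans ?_ hdist)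
    exact Finset.sum_le_sum_of_subset_of_nonneg (Finset.filter_subset _ _)
      fun _ _ _ => abs_nonneg _
  -- An arbitrary extension by `ω₀` serves as boundary condition: by `hosc`, the spins off `V`
  -- change the probability by at most `ε`.
  let ext : (V → E) → (S → E) := fun τ i => if h : i ∈ V then τ ⟨i, h⟩ else ω₀ i
  have hosc' : ∀ τ η, V.restrict η = τ →
      |(γ.ker Λ η).real A - (γ.ker Λ (ext τ)).real A| ≤ ε := by
    rintro _ η rfl
    refine hosc η _ fun i hi hiΛ => ?_
    have hiV : i ∈ V := Finset.mem_sdiff.2 ⟨hi, hiΛ⟩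
    simp [ext, hiV]
  have hcond : ∀ τ, |ν.real (A ∩ V.restrict ⁻¹' {τ}) -
      (γ.ker Λ (ext τ)).real A * marginal ν V τ| ≤ ε * marginal ν V τ := by
    intro τ
    have hB : MeasurableSet[cylinderEvents (X := fun _ : S => E) ((Λ : Set S)ᶜ)]
        (V.restrict (π := fun _ => E) ⁻¹' {τ}) := by
      refine cylinderEvents_mono (fun i hi => ?_) _ (measurable_restrict_cylinderEvents_coe V
        (measurableSet_singleton τ))
      exact (Finset.mem_sdiff.1 hi).2
    rw [hν.measureReal_inter Λ hAm hB]
    have h2 := norm_setIntegral_le_of_norm_le_const (μ := ν) (C := ε)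
      (s := V.restrict (π := fun _ => E) ⁻¹' {τ})
      (f := fun η => (γ.ker Λ η).real A - (γ.ker Λ (ext τ)).real A) (measure_lt_top _ _)
      fun η hη => hosc' τ η hη
    rw [integral_sub (γ.integrable_measureReal ν Λ hAm).integrableOn (integrable_const _),
      setIntegral_const, smul_eq_mul, mul_comm (ν.real _)] at h2
    exact h2
  have hm : ∑ σ with P σ, m σ =
      ∑ τ, marginal μ V τ * (ν.real (A ∩ V.restrict ⁻¹' {τ}) / marginal ν V τ) := by
    rw [← Finset.sum_fiberwise _ π]
    refine Finset.sum_congr rfl fun τ _ => ?_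
    have h2 : ν.real (A ∩ V.restrict ⁻¹' {τ}) = ∑ σ with P σ ∧ π σ = τ, marginal ν D σ :=
      measureReal_preimage_eq_sum (μ := ν) hDm (fun σ => P σ ∧ π σ = τ)
    rw [h2, Finset.filter_filter, Finset.sum_div, Finset.mul_sum]
    refine Finset.sum_congr rfl fun σ hσ => ?_
    simp only [m]
    rw [(Finset.mem_filter.1 hσ).2.2, mul_div_assoc]
  have hsum : ∑ τ, marginal μ V τ = 1 := by
    have := measureReal_preimage_eq_sum (μ := μ) hVm (fun _ => True)
    simpa [marginal] using this.symm
  have h2 : |∑ σ with P σ, m σ - ∑ τ, marginal μ V τ * (γ.ker Λ (ext τ)).real A| ≤ ε := by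
    rw [hm, ← Finset.sum_sub_distrib]
    calc _ ≤ ∑ τ, |marginal μ V τ * (ν.real (A ∩ V.restrict ⁻¹' {τ}) / marginal ν V τ) -
          marginal μ V τ * (γ.ker Λ (ext τ)).real A| := Finset.abs_sum_le_sum_abs _ _
      _ ≤ ∑ τ, marginal μ V τ * ε := by
          refine Finset.sum_le_sum fun τ _ => ?_
          have hp := hpos V τ
          rw [← mul_sub, abs_mul, abs_of_nonneg (show 0 ≤ marginal μ V τ from measureReal_nonneg)]
          refine mul_le_mul_of_nonneg_left ?_ measureReal_nonneg
          rw [div_sub' hp.ne', abs_div, abs_of_pos hp, div_le_iff₀ hp, mul_comm (marginal ν V τ)]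
          exact hcond τ
      _ = ε := by rw [← Finset.sum_mul, hsum, one_mul]
  have h3 : |∑ τ, marginal μ V τ * (γ.ker Λ (ext τ)).real A - ∫ ω, (γ.ker Λ ω).real A ∂μ|
      ≤ ε := by
    have h4 : ∫ ω, (γ.ker Λ (ext (V.restrict ω))).real A ∂μ =
        ∑ τ, marginal μ V τ * (γ.ker Λ (ext τ)).real A :=
      integral_comp_finite (μ := μ) hVm (fun τ => (γ.ker Λ (ext τ)).real A)
    rw [← h4, ← integral_sub (integrable_comp_finite hVm (fun τ => (γ.ker Λ (ext τ)).real A))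
      (γ.integrable_measureReal μ Λ hAm)]
    have h5 := norm_integral_le_of_norm_le_const (μ := μ) (C := ε)
      (f := fun ω => (γ.ker Λ (ext (V.restrict ω))).real A - (γ.ker Λ ω).real A)
      (Eventually.of_forall fun ω => by
        rw [Real.norm_eq_abs, abs_sub_comm]
        exact hosc' _ ω rfl)
    simpa using h5
  rw [abs_le] at h1 h2 h3 ⊢
  constructor <;> linarith [h1.1, h1.2, h2.1, h2.2, h3.1, h3.2]

end MarginalRelEntropy

/-! ### Tilings and sublinear growth -/

section Tiling

variable {d : ℕ}

/-- The translate of the cube of radius `m` with index `x` in the tiling of the lattice. -/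
noncomputable def tile (m : ℕ) (x : Fin d → ℤ) : Finset (Fin d → ℤ) :=
  (cube d m).map (addRightEmbedding ((2 * (m : ℤ) + 1) • x))

theorem mem_tile {m : ℕ} {x z : Fin d → ℤ} :
    z ∈ tile m x ↔ ∀ j, -(m : ℤ) ≤ z j - (2 * (m : ℤ) + 1) * x j ∧
      z j - (2 * (m : ℤ) + 1) * x j ≤ m := by
  have h : z ∈ tile m x ↔ z - (2 * (m : ℤ) + 1) • x ∈ cube d m := by
    simp only [tile, Finset.mem_map, addRightEmbedding_apply]
    constructor
    · rintro ⟨y, hy, rfl⟩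
      rwa [add_sub_cancel_right]
    · exact fun h => ⟨_, h, sub_add_cancel _ _⟩
  rw [h, mem_cube]
  simp

theorem eq_of_mem_tile {m : ℕ} {x y z : Fin d → ℤ} (hx : z ∈ tile m x) (hy : z ∈ tile m y) :
    x = y := by
  rw [mem_tile] at hx hy
  funext j
  have h1 := hx j
  have h2 := hy j
  have hm : (0 : ℤ) ≤ m := Int.natCast_nonneg m
  rcases lt_trichotomy (x j) (y j) with h | h | h
  · nlinarith
  · exact h
  · nlinarith

theorem tile_subset_cube {m q : ℕ} {x : Fin d → ℤ} (hx : x ∈ cube d q) :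
    tile m x ⊆ cube d (m + q * (2 * m + 1)) := by
  intro z hz
  rw [mem_tile] at hz
  rw [mem_cube] at hx ⊢
  intro j
  have h1 := hz j
  have h2 := hx j
  have hm : (0 : ℤ) ≤ m := Int.natCast_nonneg m
  push_cast
  constructor <;> nlinarith

/-- Add the tiles one at a time, with the new one moved to the origin. Deleting its copy of `Λ`
leaves all earlier tiles intact since tiles are disjoint, so by monotonicity each tile adds at least
`c`. -/
theorem mul_card_le_of_le_increment {F : Finset (Fin d → ℤ) → ℝ} (hmono : Monotone F)
    (htrans : ∀ x Λ, F (Λ.map (addRightEmbedding x)) = F Λ) (h0 : F ∅ = 0)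
    {Λ : Finset (Fin d → ℤ)} {m : ℕ} (hΛ : Λ ⊆ cube d m) {c : ℝ}
    (hc : ∀ D, cube d m ⊆ D → c ≤ F D - F (D \ Λ)) (Q : Finset (Fin d → ℤ)) :
    c * Q.card ≤ F (Q.biUnion (tile m)) := by
  induction Q using Finset.induction_on with
  | empty => simp [h0]
  | insert x Q hx ih =>
    set y : Fin d → ℤ := (2 * (m : ℤ) + 1) • x with hy
    set D := (insert x Q).biUnion (tile m) with hD
    have hxD : tile m x ⊆ D :=
      Finset.subset_biUnion_of_mem (tile m) (Finset.mem_insert_self x Q)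
    have h1 := hc (D.map (addRightEmbedding (-y))) fun z hz => by
      refine Finset.mem_map.2 ⟨z + y, hxD (Finset.mem_map.2 ⟨z, hz, rfl⟩), by simp⟩
    have h2 : F (Q.biUnion (tile m)) ≤ F (D.map (addRightEmbedding (-y)) \ Λ) := by
      rw [← htrans (-y)]
      refine hmono fun z hz => ?_
      obtain ⟨w, hw, rfl⟩ := Finset.mem_map.1 hz
      obtain ⟨x', hx', hwx'⟩ := Finset.mem_biUnion.1 hw
      refine Finset.mem_sdiff.2 ⟨Finset.mem_map.2 ⟨w, ?_, rfl⟩, fun hwΛ => hx ?_⟩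
      · exact Finset.mem_biUnion.2 ⟨x', Finset.mem_insert_of_mem hx', hwx'⟩
      · have hwx : w ∈ tile m x := Finset.mem_map.2 ⟨_, hΛ hwΛ, by simp [hy]⟩
        rwa [eq_of_mem_tile hwx hwx']
    rw [htrans] at h1
    rw [Finset.card_insert_of_notMem hx]
    push_cast
    linarith

/-- If a translation-invariant monotone function of the volume grows more slowly than the volume,
then removing a given finite set makes little difference for some large volume. -/
theorem exists_increment_lt {F : Finset (Fin d → ℤ) → ℝ} (hmono : Monotone F)
    (htrans : ∀ x Λ, F (Λ.map (addRightEmbedding x)) = F Λ) (h0 : F ∅ = 0)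
    (hlim : Tendsto (fun n => F (cube d n) / (cube d n).card) atTop (𝓝 0))
    (Λ W : Finset (Fin d → ℤ)) {ε : ℝ} (hε : 0 < ε) :
    ∃ D, W ⊆ D ∧ F D - F (D \ Λ) < ε := by
  obtain ⟨m, hm⟩ := exists_subset_cube (Λ ∪ W)
  have hΛ := Finset.subset_union_left.trans hm
  have hW := Finset.subset_union_right.trans hm
  by_contra! hcon
  have h1 : ∀ q : ℕ, ε / (2 * m + 1) ^ d ≤
      F (cube d (m + q * (2 * m + 1))) / (cube d (m + q * (2 * m + 1))).card := by
    intro q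
    have h2 := mul_card_le_of_le_increment hmono htrans h0 hΛ
      (fun D hD => hcon D (hW.trans hD)) (cube d q)
    have h3 := h2.trans (hmono (Finset.biUnion_subset.2 fun x hx => tile_subset_cube hx))
    rw [card_cube] at h3 ⊢
    -- The `(2q+1)^d` tiles have exactly the volume of this cube, so the density stays above `ε /
    -- (2m+1)^d` along these radii.
    have h4 : (((2 * (m + q * (2 * m + 1)) + 1) ^ d : ℕ) : ℝ) =
        (2 * (m : ℝ) + 1) ^ d * ((2 * q + 1) ^ d : ℕ) := by
      push_cast
      rw [← mul_pow]
      congr 1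
      ring
    rw [h4, div_le_div_iff₀ (by positivity) (by positivity)]
    have h5 : (0 : ℝ) < (2 * (m : ℝ) + 1) ^ d := by positivity
    nlinarith [mul_le_mul_of_nonneg_right h3 h5.le]
  have h2 : Tendsto (fun q : ℕ => m + q * (2 * m + 1)) atTop atTop :=
    tendsto_atTop_mono (fun q => (Nat.le_mul_of_pos_right q (by omega)).trans
      (Nat.le_add_left _ _)) tendsto_id
  have h3 := ge_of_tendsto' (hlim.comp h2) h1
  exact absurd h3 (not_le.2 (by positivity))

end Tiling

/-! ### The variational principle -/

section VariationalPrinciple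

variable {d : ℕ} {E : Type*} [Finite E] [MeasurableSpace E] [DiscreteMeasurableSpace E]
  {γ : Specification (Fin d → ℤ) E} {μ ν : Measure ((Fin d → ℤ) → E)}

theorem marginalRelEntropy_map (hμ : IsInvariantProb μ) (hν : IsInvariantProb ν)
    (x : Fin d → ℤ) (Λ : Finset (Fin d → ℤ)) :
    marginalRelEntropy μ ν (Λ.map (addRightEmbedding x)) = marginalRelEntropy μ ν Λ := by
  have := hμ.1
  rw [marginalRelEntropy, ← hμ.integral_comp_shift x
    (integrable_logMarginal_sub μ μ ν _ _).aestronglyMeasurable]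
  simp only [logMarginal_map_shift hμ, logMarginal_map_shift hν]
  rfl

/-- The term `log ν(e_Λ)` cancels between the energy limits for `μ` and for `ν`, so its own growth
need not be known. The limit is antisymmetric in `(μ, s)` and `(ν, t)`. -/
theorem tendsto_marginalRelEntropy (hql : γ.IsQuasilocal) (hnn : γ.IsNonNull)
    (hν : γ.IsInvariantDLR ν) (hμ : IsInvariantProb μ) (e : E) {s t : ℝ}
    (hs : Tendsto (fun n => (∫ ω, logMarginal μ (cube d n) ω ∂μ) / (cube d n).card) atTop (𝓝 s))
    (ht : Tendsto (fun n => (∫ ω, logMarginal ν (cube d n) ω ∂ν) / (cube d n).card) atTop (𝓝 t)) :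
    Tendsto (fun n => marginalRelEntropy μ ν (cube d n) / (cube d n).card) atTop
      (𝓝 (s - t - (∫ ω, siteEnergy γ e ω ∂μ - ∫ ω, siteEnergy γ e ω ∂ν))) := by
  have := hμ.1
  refine ((hs.sub ht).sub ((tendsto_integral_logMarginal_sub hql hnn hν hμ e).sub
    (tendsto_integral_logMarginal_sub hql hnn hν hν.2 e))).congr fun n => ?_
  rw [marginalRelEntropy, integral_sub (integrable_logMarginal μ μ _)
    (integrable_logMarginal μ ν _)]
  ring

theorem isDLR_of_tendsto_zero (hql : γ.IsQuasilocal) (hnn : γ.IsNonNull)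
    (hν : γ.IsInvariantDLR ν) (hμ : IsInvariantProb μ)
    (h : Tendsto (fun n => marginalRelEntropy μ ν (cube d n) / (cube d n).card) atTop (𝓝 0)) :
    γ.IsDLR μ := by
  have := hμ.1
  have := hν.2.1
  refine Specification.isDLR_of_integral_eq fun Λ Δ T => ?_
  refine (eq_of_abs_sub_le_all fun ε hε => ?_).symm
  obtain ⟨W, hW⟩ := hql.exists_finset Λ Δ T (show 0 < ε / 4 by positivity)
  obtain ⟨D, hD, hlt⟩ := exists_increment_lt (marginalRelEntropy_mono (hν.1.marginal_pos hnn))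
    (marginalRelEntropy_map hμ hν.2) marginalRelEntropy_empty h Λ (Δ ∪ W)
    (show 0 < (ε / 4) ^ 2 by positivity)
  have h1 := abs_measureReal_sub_integral_le (μ := μ) hν.1 (hν.1.marginal_pos hnn) T
    (Finset.subset_union_left.trans hD) (show 0 ≤ ε / 4 by positivity)
    (fun ω ω' hω => hW ω ω' fun i hi => hω i (hD (Finset.mem_union_right Δ hi))) hlt.le
  linarith

theorem hasRelEntropyDensity_of_tendsto (hnn : γ.IsNonNull) (hν : γ.IsDLR ν)
    [IsProbabilityMeasure μ] {h : ℝ}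
    (hlim : Tendsto (fun n => marginalRelEntropy μ ν (cube d n) / (cube d n).card) atTop (𝓝 h)) :
    HasRelEntropyDensity μ ν (h.toNNReal : ℝ≥0∞) := by
  have := hν.1
  refine (ENNReal.tendsto_ofReal hlim).congr fun n => ?_
  have hc : (0 : ℝ) < (cube d n).card := by
    rw [card_cube]; positivity
  rw [relEntropy_eq_ofReal μ ν (hν.marginal_pos hnn _), ENNReal.ofReal_div_of_pos hc,
    ENNReal.ofReal_natCast]
  rfl

end VariationalPrinciple

end LatticeSpin

theorem mainTheorem3 (d : ℕ) (hd : 1 ≤ d) {E : Type*} [Finite E] [MeasurableSpace E]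
    [DiscreteMeasurableSpace E] (γ : LatticeSpin.Specification (Fin d → ℤ) E)
    (hγ_inv : γ.IsTranslationInvariant) (hγ_ql : γ.IsQuasilocal) (hγ_nn : γ.IsNonNull)
    (ν : Measure ((Fin d → ℤ) → E)) (hν : γ.IsInvariantDLR ν) :
    ∀ μ : Measure ((Fin d → ℤ) → E), LatticeSpin.IsInvariantProb μ →
      ∃ h : ℝ≥0, LatticeSpin.HasRelEntropyDensity μ ν (h : ℝ≥0∞) ∧
        (h = 0 ↔ γ.IsInvariantDLR μ) := by
  intro μ hμ
  have := hμ.1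
  have := hν.2.1
  obtain ⟨ω⟩ : Nonempty ((Fin d → ℤ) → E) := nonempty_of_isProbabilityMeasure ν
  have hnonneg : ∀ {μ ν : Measure ((Fin d → ℤ) → E)}, IsProbabilityMeasure μ → γ.IsDLR ν → ∀ n,
      0 ≤ LatticeSpin.marginalRelEntropy μ ν (LatticeSpin.cube d n) /
        (LatticeSpin.cube d n).card := by
    intro μ ν hμ hν n
    have := hν.1
    refine div_nonneg ?_ (Nat.cast_nonneg _)
    rw [← LatticeSpin.marginalRelEntropy_empty (μ := μ) (ν := ν)]
    exact LatticeSpin.marginalRelEntropy_mono (hν.marginal_pos hγ_nn) (Finset.empty_subset _)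
  obtain ⟨s, hs⟩ := LatticeSpin.exists_tendsto_integral_logMarginal hμ
  obtain ⟨t, ht⟩ := LatticeSpin.exists_tendsto_integral_logMarginal hν.2
  have hlim := LatticeSpin.tendsto_marginalRelEntropy hγ_ql hγ_nn hν hμ (ω 0) hs ht
  have h0 := ge_of_tendsto' hlim (hnonneg hμ.1 hν.1)
  refine ⟨_, LatticeSpin.hasRelEntropyDensity_of_tendsto hγ_nn hν.1 hlim, fun h => ?_,
    fun hμG => ?_⟩
  · rw [le_antisymm (Real.toNNReal_eq_zero.1 h) h0] at hlim
    exact ⟨LatticeSpin.isDLR_of_tendsto_zero hγ_ql hγ_nn hν hμ hlim, hμ⟩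
  -- As `μ` is Gibbs too, the roles may be exchanged: the limit is now the negative of the former
  -- one and again nonnegative.
  · have hlim' := LatticeSpin.tendsto_marginalRelEntropy hγ_ql hγ_nn hμG hν.2 (ω 0) ht hs
    have h1 := ge_of_tendsto' hlim' (hnonneg hν.2.1 hμG.1)
    exact Real.toNNReal_eq_zero.2 (by linarith)
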